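/- Let $(W,S)$ be the Coxeter system of a Weyl group $W$ (a finite Coxeter group with $m(s,s')\in\{2,3,4,6\}$ for all distinct $s,s'\in S$), with length function $\ell$ and set of reflections $T=\{xsx^{-1}: x\in W,\ s\in S\}$. For $u,v\in W$ write $u\to v$ if $v=tu$ for some $t\in T$ and $\ell(u)<\ell(v)$; the Bruhat order on $W$ is the reflexive transitive closure of $\to$. For $u<w$ in Bruhat order let $[u,w]=\{y\in W: u\le y\le w\}$, and let $\deg_{u,w}(v)$ denote the degree of $v\in[u,w]$ in the Bruhat graph of $[u,w]$, the undirected graph with vertex set $[u,w]$ in which $x$ and $y$ are adjacent if and only if $x\to y$ or $y\to x$. A special matching of a poset $P$ is an involution $M:P\to P$ such that, for every $x\in P$, either $M(x)$ is covered by $x$ or $x$ is covered by $M(x)$, and such that, whenever $x$ is covered by $y$, either $M(x)=y$ or $M(x)<M(y)$. A poset $P$ is a zircon if for every non-minimal $x\in P$ the principal order ideal $\{v\in P: v\le x\}$ is finite and has a special matching. Let $u<w$ in $W$. If the poset $[u,w]$ is a zircon, then $$\deg_{u,w}(w)=\ell(w)-\ell(u).$$ -/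

import Mathlib

namespace BruhatZircon

section Posets

variable {P : Type*} [PartialOrder P]

/-- A matching on a poset: an involution sending each element to one that it covers or that
covers it. -/
def IsMatching (f : P → P) : Prop :=
  Function.Involutive f ∧ ∀ x, f x ⋖ x ∨ x ⋖ f x

/-- A special matching on a poset. -/
def IsSpecialMatching (f : P → P) : Prop :=
  IsMatching f ∧ ∀ x y, x ⋖ y → f x = y ∨ f x < f y

variable (P) in
/-- A zircon: every principal order ideal generated by a non-minimal element is finite and has
a special matching (as a poset in its own right). -/
def IsZircon : Prop :=
  ∀ x : P, ¬ IsMin x →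
    (Set.Iic x).Finite ∧ ∃ f : Set.Iic x → Set.Iic x, IsSpecialMatching f

end Posets

section Bruhat

variable {B W : Type*} [Group W] {M : CoxeterMatrix B} (cs : CoxeterSystem M W)

/-- The Coxeter system is that of a Weyl group: `W` is finite and crystallographic, that is,
`m(s, s') ∈ {2, 3, 4, 6}` for all distinct simple reflections `s`, `s'`. -/
def IsWeylGroup (_cs : CoxeterSystem M W) : Prop :=
  Finite W ∧ ∀ i j : B, i ≠ j → M i j = 2 ∨ M i j = 3 ∨ M i j = 4 ∨ M i j = 6

/-- `u → v`: `v = t u` for some reflection `t`, and `ℓ(u) < ℓ(v)`. -/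
def BruhatStep (u v : W) : Prop :=
  (∃ t, cs.IsReflection t ∧ v = t * u) ∧ cs.length u < cs.length v

/-- The Bruhat order: `u ≤ w` if there is a sequence `u = w₀ → w₁ → ⋯ → wₖ = w`, `k ≥ 0`. -/
def BruhatLE (u w : W) : Prop :=
  Relation.ReflTransGen (BruhatStep cs) u w

theorem BruhatLE.length_lt_or_eq {u w : W} (h : BruhatLE cs u w) :
    cs.length u < cs.length w ∨ u = w := by
  induction h with
  | refl => exact Or.inr rfl
  | tail _ hs ih =>
    left
    rcases ih with ih | rfl
    · exact ih.trans hs.2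
    · exact hs.2

theorem BruhatLE.antisymm {u w : W} (h : BruhatLE cs u w) (h' : BruhatLE cs w u) : u = w := by
  rcases h.length_lt_or_eq with h1 | h1
  · rcases h'.length_lt_or_eq with h2 | h2
    · exact absurd h1 h2.le.not_gt
    · exact h2.symm
  · exact h1

/-- The Bruhat interval `[u, w] = {y : u ≤ y ≤ w}`. -/
def bruhatInterval (u w : W) : Set W :=
  {y | BruhatLE cs u y ∧ BruhatLE cs y w}

/-- The Bruhat interval as a poset, with the Bruhat order. -/
instance bruhatIntervalPartialOrder (u w : W) : PartialOrder (bruhatInterval cs u w) where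
  le x y := BruhatLE cs x.1 y.1
  le_refl _ := Relation.ReflTransGen.refl
  le_trans _ _ _ h h' := Relation.ReflTransGen.trans h h'
  le_antisymm _ _ h h' := Subtype.ext (BruhatLE.antisymm cs h h')

theorem right_mem_bruhatInterval {u w : W} (h : BruhatLE cs u w) : w ∈ bruhatInterval cs u w :=
  ⟨h, Relation.ReflTransGen.refl⟩

/-- The (undirected) Bruhat graph of a Coxeter system. -/
def bruhatGraph : SimpleGraph W where
  Adj u v := BruhatStep cs u v ∨ BruhatStep cs v u
  symm := ⟨fun _ _ h => h.symm⟩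
  loopless := ⟨fun _ h => h.elim (fun h => lt_irrefl _ h.2) (fun h => lt_irrefl _ h.2)⟩

/-- The Bruhat graph of `[u, w]`: the induced subgraph of the Bruhat graph. -/
def intervalBruhatGraph (u w : W) : SimpleGraph (bruhatInterval cs u w) :=
  (bruhatGraph cs).induce (bruhatInterval cs u w)

/-- The degree of a vertex `v` in the Bruhat graph of `[u, w]`. -/
noncomputable def bruhatDegree (u w : W) (v : bruhatInterval cs u w) : ℕ :=
  ((intervalBruhatGraph cs u w).neighborSet v).ncard

end Bruhat

end BruhatZircon

/-!
A special matching of a Bruhat interval `[u, w]` is an automorphism of the Bruhat graph of that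
interval (`IsSpecialOn.adj_of_step`). Granting this, let `f` be a special matching of `[u, w]` and
`w' = f w`, a coatom of `[u, w]`. Then `f` restricts to a bijection between the neighbours of `w`
other than `w'` and the neighbours of `w'` in `[u, w']`, so the degree at the top drops by exactly
one on passing from `[u, w]` to `[u, w']`. The zircon condition supplies a special matching for
`[u, w']` as well, and induction on `ℓ(w)` gives the degree (`ncard_step_add_length`).

That edges are preserved is proved by induction on the difference of the lengths of the end points
`x → y`, and rests on two facts about the Bruhat graph.

* `adj_of_hexagon`: if `x`, `{a₁, a₂}`, `{b₁, b₂}`, `y` are consecutive layers with all eight edges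
  between them, then `x` and `y` are adjacent. The reflections on these edges have coplanar roots,
  a product of three reflections with coplanar roots acts as an orthogonal reflection, and an
  element acting so belongs to the reflections of the Coxeter group.
* `exists_hexagon`: if `x → y` is not a covering, then such a hexagon exists with directed edges
  `x → aᵢ → bⱼ → y`.

For an edge that is not a covering, the eight edges of the hexagon are shorter, so their images are
edges, and so is the image of `x → y`. For a covering, the only case that does not follow from the
gradedness of the Bruhat order is `f x < x < y < f y`; there the matching itself produces a hexagon
with end points `f x` and `f y` from the second atom of `[f x, y]` (`exists_diamond`).

Both `exists_diamond` and `exists_hexagon` come from the cosets of dihedral reflection subgroups.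
Fix a plane spanned by two roots and let `m` be the number of reflections with root in it. The rank
of `z` is the number of these that are inversions of `z`. On a coset of the group they generate,
edges go up in rank. Ordering the reflections by slope, the inversions of `z` form an initial or a
final segment and determine `z`, so a rank is attained at most twice, and at most once if it is `0`
or `m`. As the coset has `2m` elements, each of the ranks `1, …, m - 1` is attained exactly twice
(`exists_pair_of_rank`). A noncovering edge `x → t x` lies in a plane in which the rank jumps by at
least three, because an inversion of `t x` not accounted for by `t` and the inversions of `x` comes
with its conjugate under `t` (`exists_new_inversion`, `ncard_inversionsIn_add_three_le`).

The roots are those of the geometric representation, with an inner product averaged over the group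
(`nonempty_rootModel`).
-/

namespace BruhatZircon

section Geometric

open Real

variable {B W : Type*} [Group W] {M : CoxeterMatrix B} (cs : CoxeterSystem M W)

/-! ### The geometric representation -/

/-- The linear functional `v ↦ (αᵢ, v)` on the space spanned freely by the simple roots, where
`(αᵢ, αⱼ) = -cos (π / m(i, j))`. -/
noncomputable def titsFunctional (M : CoxeterMatrix B) (i : B) : (B →₀ ℝ) →ₗ[ℝ] ℝ :=
  Finsupp.linearCombination ℝ (fun j => -cos (π / M i j))

/-- The simple root `αᵢ`. -/
noncomputable def simpleRoot (i : B) : B →₀ ℝ := Finsupp.single i 1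

/-- The action `v ↦ v - 2 (αᵢ, v) αᵢ` of a simple reflection on the geometric representation. -/
noncomputable def simpleMap (M : CoxeterMatrix B) (i : B) : Module.End ℝ (B →₀ ℝ) :=
  LinearMap.id - (2 : ℝ) • (titsFunctional M i).smulRight (simpleRoot i)

theorem simpleMap_apply (i : B) (v : B →₀ ℝ) :
    simpleMap M i v = v - (2 * titsFunctional M i v) • simpleRoot i := by
  simp [simpleMap, smul_smul]

theorem titsFunctional_simpleRoot (i j : B) :
    titsFunctional M i (simpleRoot j) = -cos (π / M i j) := by
  simp [titsFunctional, simpleRoot]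

theorem titsFunctional_simpleRoot_self (i : B) :
    titsFunctional M i (simpleRoot i) = 1 := by
  simp [titsFunctional_simpleRoot]

theorem simpleMap_self (i : B) : simpleMap M i (simpleRoot i) = -simpleRoot i := by
  rw [simpleMap_apply, titsFunctional_simpleRoot_self]
  module

theorem simpleMap_other (i j : B) :
    simpleMap M i (simpleRoot j) = simpleRoot j + (2 * cos (π / M i j)) • simpleRoot i := by
  rw [simpleMap_apply, titsFunctional_simpleRoot]
  module

theorem simpleMap_mul_self (i : B) : simpleMap M i * simpleMap M i = 1 := by
  refine LinearMap.ext fun v => ?_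
  simp only [Module.End.mul_apply, Module.End.one_apply]
  rw [simpleMap_apply i v, map_sub, map_smul, simpleMap_self, simpleMap_apply]
  module

theorem simpleMap_mul_pow_left (i j : B) (k : ℕ) :
    sin (π / M i j) • ((simpleMap M i * simpleMap M j) ^ k) (simpleRoot i) =
      sin ((2 * k + 1) * (π / M i j)) • simpleRoot i +
        sin (2 * k * (π / M i j)) • simpleRoot j := by
  set θ := π / (M i j : ℝ) with hθ
  have hθ' : π / (M j i : ℝ) = θ := by rw [M.symmetric]
  induction k with
  | zero => simp
  | succ k ih =>
    rw [pow_succ', Module.End.mul_apply, Module.End.mul_apply, ← map_smul, ← map_smul, ih]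
    have h1 : sin ((2 * (k + 1 : ℕ) + 1) * θ) =
        2 * cos θ * (2 * cos θ * sin ((2 * k + 1) * θ) - sin (2 * k * θ))
          - sin ((2 * k + 1) * θ) := by
      have e1 : (2 * ((k + 1 : ℕ) : ℝ) + 1) * θ = (2 * k + 1) * θ + θ + θ := by push_cast; ring
      have e2 : 2 * (k : ℝ) * θ = (2 * k + 1) * θ - θ := by ring
      rw [e1, e2]
      simp only [sin_add, cos_add, sin_sub]
      linear_combination (-sin ((2 * k + 1) * θ)) * sin_sq_add_cos_sq θ
    have h2 : sin (2 * (k + 1 : ℕ) * θ) = 2 * cos θ * sin ((2 * k + 1) * θ) - sin (2 * k * θ) := by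
      have e1 : 2 * ((k + 1 : ℕ) : ℝ) * θ = (2 * k + 1) * θ + θ := by push_cast; ring
      have e2 : 2 * (k : ℝ) * θ = (2 * k + 1) * θ - θ := by ring
      rw [e1, e2]
      simp only [sin_add, sin_sub]
      ring
    rw [h1, h2]
    simp only [map_add, map_smul, simpleMap_self, simpleMap_other, ← hθ, hθ', map_neg]
    module

theorem simpleMap_mul_pow_right (i j : B) (k : ℕ) :
    sin (π / M i j) • ((simpleMap M i * simpleMap M j) ^ k) (simpleRoot j) =
      - sin (2 * k * (π / M i j)) • simpleRoot i -
        sin ((2 * k - 1) * (π / M i j)) • simpleRoot j := by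
  set θ := π / (M i j : ℝ) with hθ
  have hθ' : π / (M j i : ℝ) = θ := by rw [M.symmetric]
  induction k with
  | zero => simp
  | succ k ih =>
    rw [pow_succ', Module.End.mul_apply, Module.End.mul_apply, ← map_smul, ← map_smul, ih]
    have h1 : sin (2 * (k + 1 : ℕ) * θ) =
        2 * cos θ * (2 * cos θ * sin (2 * k * θ) - sin ((2 * k - 1) * θ))
          - sin (2 * k * θ) := by
      have e1 : 2 * ((k + 1 : ℕ) : ℝ) * θ = 2 * k * θ + θ + θ := by push_cast; ring
      have e2 : (2 * (k : ℝ) - 1) * θ = 2 * k * θ - θ := by ring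
      rw [e1, e2]
      simp only [sin_add, cos_add, sin_sub]
      linear_combination (-sin (2 * k * θ)) * sin_sq_add_cos_sq θ
    have h2 : sin ((2 * (k + 1 : ℕ) - 1) * θ) =
        2 * cos θ * sin (2 * k * θ) - sin ((2 * k - 1) * θ) := by
      have e1 : (2 * ((k + 1 : ℕ) : ℝ) - 1) * θ = 2 * k * θ + θ := by push_cast; ring
      have e2 : (2 * (k : ℝ) - 1) * θ = 2 * k * θ - θ := by ring
      rw [e1, e2]
      simp only [sin_add, sin_sub]
      ring
    rw [h1, h2]
    simp only [map_add, map_smul, simpleMap_self, simpleMap_other, ← hθ, hθ', map_neg, map_sub]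
    module

theorem sin_pi_div_pos (hM : ∀ i j, M i j ≠ 0) {i j : B} (hij : i ≠ j) :
    0 < sin (π / M i j) := by
  have h2 : (2 : ℝ) ≤ M i j := by
    have h0 := hM i j
    have h1 := M.off_diagonal i j hij
    exact_mod_cast (by omega : 2 ≤ M i j)
  apply sin_pos_of_pos_of_lt_pi
  · positivity
  · rw [div_lt_iff₀ (by linarith)]
    nlinarith [pi_pos]

/-- The braid relations hold because, in the plane spanned by `αᵢ` and `αⱼ`, the product of the
two simple reflections is the rotation by `2π / m(i, j)`, while it fixes the common kernel of the
two functionals, which complements that plane. -/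
theorem simpleMap_isLiftable (hM : ∀ i j, M i j ≠ 0) : M.IsLiftable (simpleMap M) := by
  intro i j
  rcases eq_or_ne i j with rfl | hij
  · rw [simpleMap_mul_self, one_pow]
  have hs := sin_pi_div_pos hM hij
  set θ := π / (M i j : ℝ) with hθ
  have hm : (M i j : ℝ) * θ = π := by
    have : (M i j : ℝ) ≠ 0 := by exact_mod_cast hM i j
    rw [hθ]; field_simp
  have hθ' : π / (M j i : ℝ) = θ := by rw [M.symmetric]
  have hi : ((simpleMap M i * simpleMap M j) ^ M i j) (simpleRoot i) = simpleRoot i := by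
    have h := simpleMap_mul_pow_left (M := M) i j (M i j)
    rw [← hθ, show (2 * (M i j : ℝ) + 1) * θ = θ + 2 * π by rw [← hm]; ring,
      show 2 * (M i j : ℝ) * θ = 2 * π by rw [← hm]; ring, sin_add_two_pi, sin_two_pi, zero_smul,
      add_zero] at h
    exact smul_right_injective _ hs.ne' h
  have hj : ((simpleMap M i * simpleMap M j) ^ M i j) (simpleRoot j) = simpleRoot j := by
    have h := simpleMap_mul_pow_right (M := M) i j (M i j)
    rw [← hθ, show (2 * (M i j : ℝ) - 1) * θ = 2 * π - θ by rw [← hm]; ring,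
      show 2 * (M i j : ℝ) * θ = 2 * π by rw [← hm]; ring, sin_two_pi_sub, sin_two_pi, neg_zero,
      zero_smul, zero_sub, neg_smul, neg_neg] at h
    exact smul_right_injective _ hs.ne' h
  refine LinearMap.ext fun v => ?_
  -- Split off the component of `v` in the plane of `αᵢ` and `αⱼ`; the Gram determinant of that
  -- plane is `sin² θ ≠ 0`.
  set a := titsFunctional M i v
  set b := titsFunctional M j v
  set p := (a + b * cos θ) / sin θ ^ 2 with hp
  set q := (b + a * cos θ) / sin θ ^ 2 with hq
  have hs2 : sin θ ^ 2 ≠ 0 := by positivity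
  obtain ⟨u, hu⟩ : ∃ u, u = v - p • simpleRoot i - q • simpleRoot j := ⟨_, rfl⟩
  have hv : v = u + p • simpleRoot i + q • simpleRoot j := by rw [hu]; module
  have hui : titsFunctional M i u = 0 := by
    rw [hu, map_sub, map_sub, map_smul, map_smul, titsFunctional_simpleRoot_self,
      titsFunctional_simpleRoot, ← hθ, smul_eq_mul, smul_eq_mul, hp, hq]
    change a - _ - _ = 0
    field_simp
    linear_combination a * sin_sq_add_cos_sq θ
  have huj : titsFunctional M j u = 0 := by
    rw [hu, map_sub, map_sub, map_smul, map_smul, titsFunctional_simpleRoot_self,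
      titsFunctional_simpleRoot, hθ', smul_eq_mul, smul_eq_mul, hp, hq]
    change b - _ - _ = 0
    field_simp
    linear_combination b * sin_sq_add_cos_sq θ
  have hfix : ∀ k : ℕ, ((simpleMap M i * simpleMap M j) ^ k) u = u := by
    intro k
    induction k with
    | zero => simp
    | succ k ih =>
      rw [pow_succ', Module.End.mul_apply, ih, Module.End.mul_apply, simpleMap_apply j, huj,
        mul_zero, zero_smul, sub_zero, simpleMap_apply, hui, mul_zero, zero_smul, sub_zero]
  rw [Module.End.one_apply]
  conv_lhs => rw [hv]
  rw [map_add, map_add, map_smul, map_smul, hi, hj, hfix, ← hv]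

/-- The geometric representation of a Coxeter group. -/
noncomputable def geomRep (hM : ∀ i j, M i j ≠ 0) : W →* Module.End ℝ (B →₀ ℝ) :=
  cs.lift ⟨simpleMap M, simpleMap_isLiftable hM⟩

variable (hM : ∀ i j, M i j ≠ 0)

theorem geomRep_simple (i : B) : geomRep cs hM (cs.simple i) = simpleMap M i :=
  cs.lift_apply_simple _ i

theorem geomRep_mul_apply (x y : W) (v : B →₀ ℝ) :
    geomRep cs hM (x * y) v = geomRep cs hM x (geomRep cs hM y v) := by
  rw [map_mul, Module.End.mul_apply]

theorem geomRep_inv_apply_self (x : W) (v : B →₀ ℝ) :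
    geomRep cs hM x⁻¹ (geomRep cs hM x v) = v := by
  rw [← geomRep_mul_apply, inv_mul_cancel, map_one, Module.End.one_apply]

theorem geomRep_apply_inv_self (x : W) (v : B →₀ ℝ) :
    geomRep cs hM x (geomRep cs hM x⁻¹ v) = v := by
  rw [← geomRep_mul_apply, mul_inv_cancel, map_one, Module.End.one_apply]

/-! ### Positive and negative roots -/

theorem geomRep_alternatingWord (i j : B) (k : ℕ) :
    sin (π / M i j) • geomRep cs hM (cs.wordProd (CoxeterSystem.alternatingWord i j k))
        (simpleRoot i) =
      sin ((k + 1) * (π / M i j)) • simpleRoot (if Even k then i else j) +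
        sin (k * (π / M i j)) • simpleRoot (if Even k then j else i) := by
  induction k using Nat.strong_induction_on generalizing i j with
  | _ k ih =>
    set θ := π / (M i j : ℝ) with hθ
    have hθ' : π / (M j i : ℝ) = θ := by rw [M.symmetric]
    match k, ih with
    | 0, _ => simp [CoxeterSystem.alternatingWord]
    | 1, _ =>
      simp only [CoxeterSystem.alternatingWord, List.concat_eq_append, List.nil_append,
        CoxeterSystem.wordProd_singleton, geomRep_simple, simpleMap_other, hθ']
      have : sin ((((1 : ℕ) : ℝ) + 1) * θ) = 2 * sin θ * cos θ := by
        rw [← sin_two_mul]; norm_num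
      rw [this]
      simp only [Nat.not_even_one, if_false, Nat.cast_one, one_mul]
      module
    | k + 2, ih =>
      have e0 := ih k (by omega) i j
      have e1 := ih (k + 1) (by omega) j i
      have e2 : geomRep cs hM (cs.wordProd (CoxeterSystem.alternatingWord j i (k + 1)))
          (simpleRoot i) =
            -geomRep cs hM (cs.wordProd (CoxeterSystem.alternatingWord i j k)) (simpleRoot i) := by
        rw [CoxeterSystem.alternatingWord_succ, CoxeterSystem.wordProd_concat, geomRep_mul_apply,
          geomRep_simple, simpleMap_self, map_neg]
      rw [hθ'] at e1
      rw [← hθ] at e0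
      rw [CoxeterSystem.alternatingWord_succ, CoxeterSystem.wordProd_concat, geomRep_mul_apply,
        geomRep_simple, simpleMap_other, hθ', map_add, map_smul, e2, smul_add, smul_neg,
        smul_comm, e1, e0]
      have h1 : sin (((k + 2 : ℕ) + 1) * θ) =
          2 * cos θ * sin (((k + 1 : ℕ) + 1) * θ) - sin ((k + 1) * θ) := by
        rw [show (((k + 2 : ℕ) : ℝ) + 1) * θ = ((k + 1 : ℕ) + 1) * θ + θ by push_cast; ring,
          show ((k : ℝ) + 1) * θ = ((k + 1 : ℕ) + 1) * θ - θ by push_cast; ring, sin_add, sin_sub]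
        ring
      have h2 : sin ((k + 2 : ℕ) * θ) = 2 * cos θ * sin ((k + 1 : ℕ) * θ) - sin (k * θ) := by
        rw [show ((k + 2 : ℕ) : ℝ) * θ = (k + 1 : ℕ) * θ + θ by push_cast; ring,
          show (k : ℝ) * θ = (k + 1 : ℕ) * θ - θ by push_cast; ring, sin_add, sin_sub]
        ring
      rw [h1, h2]
      rcases Nat.even_or_odd k with hk | hk
      · have hk1 : ¬ Even (k + 1) := by rw [Nat.even_add_one]; simpa using hk
        have hk2 : Even (k + 2) := by rw [Nat.even_add]; simp [hk]
        simp only [hk, hk1, hk2, if_true, if_false]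
        module
      · have hk0 : ¬ Even k := by simpa using hk
        have hk1 : Even (k + 1) := by rw [Nat.even_add_one]; exact hk0
        have hk2 : ¬ Even (k + 2) := by rw [Nat.even_add]; simp [hk0]
        simp only [hk0, hk1, hk2, if_true, if_false]
        module

/-- If `ℓ(w sᵢ) > ℓ(w)` then `w αᵢ` is a nonnegative combination of simple roots. The proof
strips from the right of `w` a maximal alternating word in `sⱼ` and `sᵢ`, where `sⱼ` is a right
descent of `w`; the image of `αᵢ` under that word is a nonnegative combination of `αᵢ` and `αⱼ`
as the word has fewer than `m(i, j)` letters, and the remaining factor lengthens on the right by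
both `sᵢ` and `sⱼ`. -/
theorem geomRep_simpleRoot_nonneg (w : W) (i : B) (h : cs.length w < cs.length (w * cs.simple i)) :
    ∀ b, 0 ≤ geomRep cs hM w (simpleRoot i) b := by
  induction hn : cs.length w using Nat.strong_induction_on generalizing w i with
  | _ n ih =>
  subst hn
  rcases eq_or_ne w 1 with rfl | hw
  · intro b
    rw [map_one, Module.End.one_apply, simpleRoot]
    exact (Finsupp.single_nonneg.2 zero_le_one : (0 : B →₀ ℝ) ≤ _) b
  obtain ⟨j, hj⟩ := cs.exists_rightDescent_of_ne_one hw
  have hij : i ≠ j := by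
    rintro rfl
    exact absurd hj (by rw [CoxeterSystem.IsRightDescent]; omega)
  let A : ℕ → W := fun k => cs.wordProd (CoxeterSystem.alternatingWord i j k)
  have hA0 : A 0 = 1 := by simp [A, CoxeterSystem.alternatingWord]
  have hAs : ∀ k, A (k + 1) = cs.simple (if Even k then j else i) * A k := fun k => by
    simp only [A, CoxeterSystem.alternatingWord_succ', CoxeterSystem.wordProd_cons]
  let P : ℕ → Prop := fun k => cs.length (w * (A k)⁻¹) + k = cs.length w
  have hP0 : P 0 := by simp [P, hA0]
  have hP1 : P 1 := by
    have : A 1 = cs.simple j := by rw [hAs, hA0]; simp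
    have h3 := (cs.isRightDescent_iff).1 hj
    simpa [P, this] using h3
  have hex : ∃ k, ¬ P (k + 1) := ⟨cs.length w, by simp only [P]; omega⟩
  classical
  obtain ⟨k, hk, hmin⟩ : ∃ k, ¬ P (k + 1) ∧ ∀ l < k, P (l + 1) :=
    ⟨Nat.find hex, Nat.find_spec hex, fun l hl => not_not.1 (Nat.find_min hex hl)⟩
  have hPle : ∀ l ≤ k, P l := by
    rintro (_ | l) hl
    · exact hP0
    · exact hmin l (by omega)
  have hk1 : 1 ≤ k := by
    by_contra h0
    obtain rfl : k = 0 := by omega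
    exact hk hP1
  have hkm : k < M i j := by
    by_contra hle
    have hPm := hPle (M i j) (by omega)
    obtain ⟨m, hm⟩ : ∃ m, M i j = m + 1 := ⟨M i j - 1, by have := hM i j; omega⟩
    have hb : A (M i j) = cs.wordProd (CoxeterSystem.alternatingWord i j m) * cs.simple i := by
      have := cs.wordProd_braidWord_eq i j
      simp only [CoxeterSystem.braidWord] at this
      rw [M.symmetric j i] at this
      simp only [A]
      rw [this, hm, CoxeterSystem.alternatingWord_succ, CoxeterSystem.wordProd_concat]
    have hws : w * cs.simple i = (w * (A (M i j))⁻¹) *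
        cs.wordProd (CoxeterSystem.alternatingWord i j m) := by
      have : cs.wordProd (CoxeterSystem.alternatingWord i j m) = A (M i j) * cs.simple i := by
        rw [hb]; simp
      rw [this]
      group
    have h1 := cs.length_mul_le (w * (A (M i j))⁻¹)
      (cs.wordProd (CoxeterSystem.alternatingWord i j m))
    have h2 := cs.length_wordProd_le (CoxeterSystem.alternatingWord i j m)
    rw [CoxeterSystem.length_alternatingWord] at h2
    rw [← hws] at h1
    simp only [P] at hPm
    omega
  set v := w * (A k)⁻¹ with hv
  have hwv : w = v * A k := by rw [hv]; group
  have hPk : cs.length v + k = cs.length w := hPle k le_rfl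
  have hup : cs.length v < cs.length (v * cs.simple (if Even k then j else i)) := by
    have : v * cs.simple (if Even k then j else i) = w * (A (k + 1))⁻¹ := by
      rw [hAs, mul_inv_rev, cs.inv_simple, ← mul_assoc]
    rcases cs.length_mul_simple v (if Even k then j else i) with h1 | h1
    · omega
    · exfalso
      apply hk
      simp only [P]
      rw [← this]
      omega
  have hdown : cs.length v < cs.length (v * cs.simple (if Even k then i else j)) := by
    obtain ⟨l, rfl⟩ : ∃ l, k = l + 1 := ⟨k - 1, by omega⟩
    have hl : (if Even (l + 1) then i else j) = if Even l then j else i := by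
      by_cases hl : Even l <;> simp [Nat.even_add_one, hl]
    have : v * cs.simple (if Even l then j else i) = w * (A l)⁻¹ := by
      rw [hv, hAs, mul_inv_rev, cs.inv_simple, ← mul_assoc]
      simp
    rw [hl, this]
    have h1 : cs.length (w * (A l)⁻¹) + l = cs.length w := hPle l (by omega)
    omega
  have hsin := sin_pi_div_pos hM hij
  have hm0 : (0 : ℝ) < M i j := by exact_mod_cast Nat.pos_of_ne_zero (hM i j)
  have hnn : ∀ l : ℕ, l ≤ M i j → 0 ≤ sin (l * (π / M i j)) := by
    intro l hl
    apply sin_nonneg_of_nonneg_of_le_pi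
    · positivity
    · rw [← mul_div_assoc, div_le_iff₀ hm0, mul_comm]
      exact mul_le_mul_of_nonneg_left (by exact_mod_cast hl) pi_pos.le
  intro b
  have key := congrArg (geomRep cs hM v) (geomRep_alternatingWord cs hM i j k)
  rw [map_smul, ← geomRep_mul_apply, map_add, map_smul, map_smul] at key
  change sin _ • geomRep cs hM (v * A k) _ = _ at key
  rw [← hwv] at key
  have key' := DFunLike.congr_fun key b
  simp only [Finsupp.add_apply, Finsupp.smul_apply, smul_eq_mul] at key'
  have hp1 := ih _ (by omega) v _ hup rfl b
  have hp2 := ih _ (by omega) v _ hdown rfl b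
  have hs1 := hnn k hkm.le
  have hs2 := hnn (k + 1) hkm
  push_cast at hs2
  refine nonneg_of_mul_nonneg_right ?_ hsin
  rw [key']
  positivity

theorem geomRep_simpleRoot_nonpos (w : W) (i : B) (h : cs.length (w * cs.simple i) < cs.length w) :
    ∀ b, geomRep cs hM w (simpleRoot i) b ≤ 0 := by
  intro b
  have := geomRep_simpleRoot_nonneg cs hM (w * cs.simple i) i (by simpa using h) b
  rw [geomRep_mul_apply, geomRep_simple, simpleMap_self, map_neg, Finsupp.neg_apply] at this
  linarith

theorem simpleRoot_ne_zero (i : B) : simpleRoot i ≠ 0 := by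
  simp [simpleRoot]

theorem geomRep_faithful {w : W} (h : geomRep cs hM w = 1) : w = 1 := by
  by_contra hw
  obtain ⟨i, hi⟩ := cs.exists_rightDescent_of_ne_one hw
  have := geomRep_simpleRoot_nonpos cs hM w i hi i
  rw [h, Module.End.one_apply] at this
  simp [simpleRoot] at this
  linarith

end Geometric

/-! ### Models of a Coxeter group as a group generated by orthogonal reflections -/

/-- A faithful orthogonal representation of a Coxeter group in which the reflections of the group
are precisely the elements acting as orthogonal reflections, each with a chosen positive unit root
`root t`. Positivity of roots is measured by the linear functional `height`, and the inversions of
`w` are the reflections whose root is sent by `w⁻¹` to a negative root. The value of `root` off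
the reflections is irrelevant. -/
structure RootModel {B W : Type*} [Group W] {M : CoxeterMatrix B} (cs : CoxeterSystem M W)
    (V : Type*) [AddCommGroup V] [Module ℝ V] where
  /-- the action of the group -/
  rep : W →* Module.End ℝ V
  /-- the invariant inner product -/
  form : V →ₗ[ℝ] V →ₗ[ℝ] ℝ
  /-- the functional that decides which roots are positive -/
  height : V →ₗ[ℝ] ℝ
  /-- the positive unit root of a reflection -/
  root : W → V
  form_symm : ∀ x y, form x y = form y x
  form_pos : ∀ x, x ≠ 0 → 0 < form x x
  form_inv : ∀ w x y, form (rep w x) (rep w y) = form x y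
  rep_inj : ∀ w, rep w = 1 → w = 1
  root_unit : ∀ t, cs.IsReflection t → form (root t) (root t) = 1
  rep_reflection : ∀ t, cs.IsReflection t → ∀ v, rep t v = v - (2 * form (root t) v) • root t
  height_root_pos : ∀ t, cs.IsReflection t → 0 < height (root t)
  inversion_iff : ∀ t, cs.IsReflection t → ∀ w,
    cs.length (t * w) < cs.length w ↔ height (rep w⁻¹ (root t)) < 0
  isReflection_of_rep : ∀ g γ, form γ γ = 1 → (∀ v, rep g v = v - (2 * form γ v) • γ) →
    cs.IsReflection g
  length_eq_ncard : ∀ w, cs.length w = {t | cs.IsLeftInversion w t}.ncard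

section Construction

variable {B W : Type*} [Group W] {M : CoxeterMatrix B} (cs : CoxeterSystem M W)
  (hM : ∀ i j, M i j ≠ 0)

theorem simple_injective (hM : ∀ i j, M i j ≠ 0) : Function.Injective cs.simple := by
  intro i j h
  by_contra hij
  have h1 := geomRep_simple cs hM i
  rw [h, geomRep_simple] at h1
  have h2 := DFunLike.congr_fun (DFunLike.congr_fun h1 (simpleRoot i)) i
  rw [simpleMap_self, simpleMap_other] at h2
  simp [simpleRoot, Ne.symm hij] at h2
  linarith

/-- The standard inner product averaged over the group. -/
theorem exists_invariant_form [Finite W] :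
    ∃ F : (B →₀ ℝ) →ₗ[ℝ] (B →₀ ℝ) →ₗ[ℝ] ℝ, (∀ x y, F x y = F y x) ∧ (∀ x, x ≠ 0 → 0 < F x x) ∧
      ∀ w x y, F (geomRep cs hM w x) (geomRep cs hM w y) = F x y := by
  have := Fintype.ofFinite W
  have : Finite B := Finite.of_injective _ (simple_injective cs hM)
  have := Fintype.ofFinite B
  refine ⟨LinearMap.mk₂ ℝ (fun x y => ∑ w, ∑ b, geomRep cs hM w x b * geomRep cs hM w y b)
    ?_ ?_ ?_ ?_, ?_, ?_, ?_⟩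
  · intros; simp [add_mul, Finset.sum_add_distrib]
  · intros; simp [Finset.mul_sum, mul_assoc]
  · intros; simp [mul_add, Finset.sum_add_distrib]
  · intros; simp [Finset.mul_sum, mul_left_comm]
  · intro x y
    simp only [LinearMap.mk₂_apply, mul_comm]
  · intro x hx
    rw [LinearMap.mk₂_apply]
    obtain ⟨b, hb⟩ := Finsupp.ne_iff.1 hx
    refine Finset.sum_pos' (fun w _ => Finset.sum_nonneg fun b _ => mul_self_nonneg _)
      ⟨1, Finset.mem_univ _, Finset.sum_pos' (fun b _ => mul_self_nonneg _)
        ⟨b, Finset.mem_univ _, ?_⟩⟩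
    rw [map_one, Module.End.one_apply]
    exact mul_self_pos.2 hb
  · intro w x y
    simp only [LinearMap.mk₂_apply, ← geomRep_mul_apply]
    exact (Group.mulRight_bijective w).sum_comp
      (fun v => ∑ b, geomRep cs hM v x b * geomRep cs hM v y b)

variable {F : (B →₀ ℝ) →ₗ[ℝ] (B →₀ ℝ) →ₗ[ℝ] ℝ}

theorem titsFunctional_eq_of_invariant
    (hinv : ∀ w x y, F (geomRep cs hM w x) (geomRep cs hM w y) = F x y) (i : B) (v : B →₀ ℝ) :
    titsFunctional M i v * F (simpleRoot i) (simpleRoot i) = F (simpleRoot i) v := by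
  have h := hinv (cs.simple i) (simpleRoot i) v
  rw [geomRep_simple, simpleMap_self, simpleMap_apply] at h
  simp only [map_neg, LinearMap.neg_apply, map_sub, map_smul, smul_eq_mul] at h
  linarith

/-- Every reflection acts as the orthogonal reflection along a unit vector with nonnegative
coordinates. -/
theorem exists_root (hF : ∀ x, x ≠ 0 → 0 < F x x)
    (hinv : ∀ w x y, F (geomRep cs hM w x) (geomRep cs hM w y) = F x y) {t : W}
    (ht : cs.IsReflection t) :
    ∃ β, F β β = 1 ∧ (∀ b, 0 ≤ β b) ∧ ∀ v, geomRep cs hM t v = v - (2 * F β v) • β := by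
  obtain ⟨w, i, rfl⟩ := ht
  set N := F (simpleRoot i) (simpleRoot i) with hN
  have hNpos : 0 < N := hF _ (simpleRoot_ne_zero i)
  set c := (√N)⁻¹ with hc
  have hcc : c * c * N = 1 := by
    rw [hc, ← mul_inv, Real.mul_self_sqrt hNpos.le]
    exact inv_mul_cancel₀ hNpos.ne'
  have key : ∀ ε : ℝ, ε * ε = 1 → (∀ b, 0 ≤ (ε * c) * geomRep cs hM w (simpleRoot i) b) →
      ∃ β, F β β = 1 ∧ (∀ b, 0 ≤ β b) ∧
        ∀ v, geomRep cs hM (w * cs.simple i * w⁻¹) v = v - (2 * F β v) • β := by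
    intro ε hε hnn
    refine ⟨(ε * c) • geomRep cs hM w (simpleRoot i), ?_, hnn, ?_⟩
    · simp only [map_smul, LinearMap.smul_apply, smul_eq_mul, hinv, ← hN]
      linear_combination hcc + c * c * N * hε
    · intro v
      have h1 : F (geomRep cs hM w (simpleRoot i)) v =
          titsFunctional M i (geomRep cs hM w⁻¹ v) * N := by
        rw [titsFunctional_eq_of_invariant cs hM hinv, ← hinv w (simpleRoot i),
          geomRep_apply_inv_self]
      rw [geomRep_mul_apply, geomRep_mul_apply, geomRep_simple, simpleMap_apply, map_sub,
        geomRep_apply_inv_self, map_smul, map_smul, LinearMap.smul_apply, h1, smul_smul,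
        smul_eq_mul]
      congr 2
      linear_combination (-2 * titsFunctional M i (geomRep cs hM w⁻¹ v)) * (hcc + c * c * N * hε)
  have hc0 : 0 ≤ c := by positivity
  rcases lt_or_gt_of_ne (cs.length_mul_simple_ne w i) with h | h
  · refine key (-1) (by norm_num) fun b => ?_
    have := geomRep_simpleRoot_nonpos cs hM w i h b
    nlinarith
  · refine key 1 (by norm_num) fun b => ?_
    have := geomRep_simpleRoot_nonneg cs hM w i h b
    nlinarith

theorem geomRep_root (hinv : ∀ w x y, F (geomRep cs hM w x) (geomRep cs hM w y) = F x y)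
    {w t : W} {β β' : B →₀ ℝ} (hβ : F β β = 1) (hβ' : F β' β' = 1)
    (ht : ∀ v, geomRep cs hM t v = v - (2 * F β v) • β)
    (ht' : ∀ v, geomRep cs hM (w * t * w⁻¹) v = v - (2 * F β' v) • β') :
    geomRep cs hM w β = β' ∨ geomRep cs hM w β = -β' := by
  have h1 := ht' (geomRep cs hM w β)
  rw [geomRep_mul_apply, geomRep_inv_apply_self, geomRep_mul_apply, ht, hβ, mul_one, map_sub,
    map_smul] at h1
  set c := F β' (geomRep cs hM w β)
  have h2 : geomRep cs hM w β = c • β' := by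
    have h3 : (2 : ℝ) • geomRep cs hM w β = (2 : ℝ) • c • β' := by
      linear_combination (norm := module) (-1 : ℝ) • h1
    exact smul_right_injective _ two_ne_zero h3
  have h3 : c * c = 1 := by
    have := hinv w β β
    rw [h2, hβ, map_smul, map_smul, LinearMap.smul_apply, hβ'] at this
    simpa using this
  rcases mul_self_eq_one_iff.1 h3 with h | h
  · left; rw [h2, h, one_smul]
  · right; rw [h2, h, neg_one_smul]

/-- A reflection whose root is proportional to a simple root is that simple reflection. -/
theorem eq_simple_of_root (hinv : ∀ w x y, F (geomRep cs hM w x) (geomRep cs hM w y) = F x y)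
    {t : W} {β : B →₀ ℝ} (hβ : F β β = 1) (ht : ∀ v, geomRep cs hM t v = v - (2 * F β v) • β)
    {i : B} {c : ℝ} (h : β = c • simpleRoot i) : t = cs.simple i := by
  have h1 : geomRep cs hM (t * cs.simple i) = 1 := by
    rw [map_mul]
    have : geomRep cs hM t = geomRep cs hM (cs.simple i) := by
      refine LinearMap.ext fun v => ?_
      rw [geomRep_simple, simpleMap_apply, ht, h]
      have h2 := titsFunctional_eq_of_invariant cs hM hinv i v
      rw [h] at hβ
      simp only [map_smul, LinearMap.smul_apply, smul_eq_mul] at hβ ⊢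
      rw [smul_smul]
      congr 2
      linear_combination (-2 * c * c) * h2 + 2 * titsFunctional M i v * hβ
    rw [this, ← map_mul, cs.simple_mul_simple_self, map_one]
  have h2 := geomRep_faithful cs hM h1
  rw [← cs.inv_simple]
  exact eq_inv_of_mul_eq_one_left h2

theorem simpleMap_apply_of_ne {i b : B} (hb : b ≠ i) (v : B →₀ ℝ) : simpleMap M i v b = v b := by
  rw [simpleMap_apply]
  simp [simpleRoot, hb.symm]

theorem eq_smul_simpleRoot {i : B} {v : B →₀ ℝ} (h : ∀ b, b ≠ i → v b = 0) :
    v = v i • simpleRoot i := by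
  ext b
  rcases eq_or_ne b i with rfl | hb
  · simp [simpleRoot]
  · simp [simpleRoot, h b hb, hb.symm]

/-- A group element acting as an orthogonal reflection is a reflection of the Coxeter group: by
conjugating with a descent its length drops, until the descent itself is that element. -/
theorem isReflection_of_geomRep
    (hF : ∀ x, x ≠ 0 → 0 < F x x)
    (hinv : ∀ w x y, F (geomRep cs hM w x) (geomRep cs hM w y) = F x y) (g : W) (γ : B →₀ ℝ)
    (hγ : F γ γ = 1) (hg : ∀ v, geomRep cs hM g v = v - (2 * F γ v) • γ) :
    cs.IsReflection g := by
  induction hn : cs.length g using Nat.strong_induction_on generalizing g γ with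
  | _ n ih =>
  subst hn
  have hγ0 : γ ≠ 0 := by rintro rfl; simp at hγ
  have hg1 : g ≠ 1 := by
    rintro rfl
    have := hg γ
    rw [map_one, Module.End.one_apply, hγ, mul_one] at this
    have h2 : (2 : ℝ) • γ = 0 := by linear_combination (norm := module) (1 : ℝ) • this
    exact hγ0 ((smul_eq_zero.1 h2).resolve_left two_ne_zero)
  have hgg : g * g = 1 := by
    apply geomRep_faithful cs hM
    refine LinearMap.ext fun v => ?_
    rw [geomRep_mul_apply, hg v, hg, map_sub, map_smul, hγ, Module.End.one_apply, smul_eq_mul]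
    module
  have hginv : g⁻¹ = g := inv_eq_of_mul_eq_one_left hgg
  obtain ⟨i, hi⟩ := cs.exists_rightDescent_of_ne_one hg1
  have hleft : cs.length (cs.simple i * g) < cs.length g := by
    rw [← cs.length_inv, mul_inv_rev, cs.inv_simple, hginv]
    exact hi
  by_cases hlt : cs.length (cs.simple i * g * (cs.simple i)⁻¹) < cs.length g
  · have hrep : ∀ v, geomRep cs hM (cs.simple i * g * (cs.simple i)⁻¹) v =
        v - (2 * F (geomRep cs hM (cs.simple i) γ) v) • geomRep cs hM (cs.simple i) γ := by
      intro v
      rw [geomRep_mul_apply, geomRep_mul_apply, hg, map_sub, map_smul, geomRep_apply_inv_self,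
        ← hinv (cs.simple i) γ, geomRep_apply_inv_self]
    have := ih _ hlt _ _ (by rw [hinv, hγ]) hrep rfl
    exact (cs.isReflection_conj_iff _ _).1 this
  · rw [cs.inv_simple] at hlt
    have hneg := geomRep_simpleRoot_nonpos cs hM g i hi
    have hpos := geomRep_simpleRoot_nonneg cs hM (cs.simple i * g) i (by omega)
    have h1 : geomRep cs hM g (simpleRoot i) =
        (geomRep cs hM g (simpleRoot i) i) • simpleRoot i := by
      refine eq_smul_simpleRoot fun b hb => le_antisymm (hneg b) ?_
      have := hpos b
      rwa [geomRep_mul_apply, geomRep_simple, simpleMap_apply_of_ne hb] at this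
    set k := geomRep cs hM g (simpleRoot i) i with hk
    have hN := hF _ (simpleRoot_ne_zero i)
    have hk1 : k * k = 1 := by
      have := hinv g (simpleRoot i) (simpleRoot i)
      rw [h1, map_smul, map_smul, LinearMap.smul_apply, smul_eq_mul, smul_eq_mul,
        ← mul_assoc] at this
      exact mul_right_cancel₀ hN.ne' (by rw [this, one_mul])
    have hk2 : k = -1 := by
      rcases mul_self_eq_one_iff.1 hk1 with h | h
      · have := hneg i
        rw [← hk, h] at this
        linarith
      · exact h
    rw [hk2, hg] at h1
    have h2 : simpleRoot i = F γ (simpleRoot i) • γ := by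
      have h3 : (2 : ℝ) • simpleRoot i = (2 : ℝ) • F γ (simpleRoot i) • γ := by
        linear_combination (norm := module) (1 : ℝ) • h1
      exact smul_right_injective _ two_ne_zero h3
    have h0 : F γ (simpleRoot i) ≠ 0 := by
      intro h0
      rw [h0, zero_smul] at h2
      exact simpleRoot_ne_zero i h2
    have h3 : γ = (F γ (simpleRoot i))⁻¹ • simpleRoot i := by
      conv_rhs => rw [h2]
      rw [map_smul, hγ, smul_smul, smul_eq_mul, mul_one, inv_mul_cancel₀ h0, one_smul]
    rw [eq_simple_of_root cs hM hinv hγ hg h3]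
    exact cs.isReflection_simple i

/-- A Coxeter system of a finite group without infinite bonds has a root model. -/
theorem nonempty_rootModel [Finite W] (hM : ∀ i j, M i j ≠ 0) :
    Nonempty (RootModel cs (B →₀ ℝ)) := by
  classical
  obtain ⟨F, hsymm, hpos, hinv⟩ := exists_invariant_form cs hM
  have hex : ∀ t, ∃ β, cs.IsReflection t →
      F β β = 1 ∧ (∀ b, 0 ≤ β b) ∧ ∀ v, geomRep cs hM t v = v - (2 * F β v) • β := by
    intro t
    by_cases ht : cs.IsReflection t
    · obtain ⟨β, h⟩ := exists_root cs hM hpos hinv ht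
      exact ⟨β, fun _ => h⟩
    · exact ⟨0, fun h => absurd h ht⟩
  choose β hβ using hex
  let h : (B →₀ ℝ) →ₗ[ℝ] ℝ := Finsupp.linearCombination ℝ (fun _ => (1 : ℝ))
  have hh : ∀ t, cs.IsReflection t → 0 < h (β t) := by
    intro t ht
    obtain ⟨h1, h2, -⟩ := hβ t ht
    have h0 : β t ≠ 0 := by intro h0; rw [h0] at h1; simp at h1
    obtain ⟨b, hb⟩ := Finsupp.ne_iff.1 h0
    simp only [h, Finsupp.linearCombination_apply, Finsupp.sum, smul_eq_mul, mul_one]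
    exact Finset.sum_pos' (fun b _ => h2 b)
      ⟨b, by simpa using hb, lt_of_le_of_ne (h2 b) (Ne.symm hb)⟩
  have hconj : ∀ w t, cs.IsReflection t →
      geomRep cs hM w (β t) = β (w * t * w⁻¹) ∨ geomRep cs hM w (β t) = -β (w * t * w⁻¹) := by
    intro w t ht
    have h1 := hβ t ht
    have h2 := hβ _ (ht.conj w)
    exact geomRep_root cs hM hinv h1.1 h2.1 h1.2.2 h2.2.2
  -- A simple reflection permutes the positive roots other than its own.
  have hsimple : ∀ i t, cs.IsReflection t → t ≠ cs.simple i →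
      geomRep cs hM (cs.simple i) (β t) = β (cs.simple i * t * (cs.simple i)⁻¹) := by
    intro i t ht hti
    refine (hconj (cs.simple i) t ht).resolve_right fun hneg => hti ?_
    obtain ⟨h1, h2, h3⟩ := hβ t ht
    refine eq_simple_of_root cs hM hinv h1 h3 (eq_smul_simpleRoot (i := i) fun b hb => ?_)
    have h4 := DFunLike.congr_fun hneg b
    rw [geomRep_simple, simpleMap_apply_of_ne hb, Finsupp.neg_apply] at h4
    have := (hβ _ (ht.conj (cs.simple i))).2.1 b
    linarith [h2 b]
  have hmem : ∀ (ω : List B) t, cs.IsReflection t →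
      h (geomRep cs hM (cs.wordProd ω)⁻¹ (β t)) < 0 → t ∈ cs.leftInvSeq ω := by
    intro ω
    induction ω with
    | nil =>
      intro t ht hlt
      have := hh t ht
      simp at hlt
      linarith
    | cons i ω ih =>
      intro t ht hlt
      rw [CoxeterSystem.leftInvSeq, List.mem_cons]
      by_cases hti : t = cs.simple i
      · exact Or.inl hti
      right
      rw [cs.wordProd_cons, mul_inv_rev, cs.inv_simple, geomRep_mul_apply,
        hsimple i t ht hti] at hlt
      refine List.mem_map.2 ⟨_, ih _ (ht.conj _) hlt, ?_⟩
      simp [mul_assoc]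
  have hlt : ∀ t, cs.IsReflection t → ∀ w, h (geomRep cs hM w⁻¹ (β t)) < 0 →
      cs.length (t * w) < cs.length w := by
    intro t ht w hw
    obtain ⟨ω, hω, rfl⟩ := cs.exists_isReduced w
    exact (cs.isLeftInversion_of_mem_leftInvSeq hω (hmem ω t ht hw)).2
  have hiff : ∀ t, cs.IsReflection t → ∀ w,
      cs.length (t * w) < cs.length w ↔ h (geomRep cs hM w⁻¹ (β t)) < 0 := by
    intro t ht w
    refine ⟨fun hl => ?_, hlt t ht w⟩
    by_contra hnn
    have h1 := hlt t ht (t * w) (by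
      obtain ⟨hu, -, h3⟩ := hβ t ht
      have h4 : geomRep cs hM t (β t) = -β t := by
        rw [h3, hu]; module
      rw [mul_inv_rev, ht.inv, geomRep_mul_apply, h4, map_neg, map_neg, neg_lt_zero]
      refine lt_of_le_of_ne (not_lt.1 hnn) fun h0 => ?_
      have h5 := hh _ (ht.conj w⁻¹)
      rcases hconj w⁻¹ t ht with h6 | h6 <;> rw [h6] at h0
      · exact h5.ne h0
      · rw [map_neg] at h0; linarith)
    rw [← mul_assoc, ht.mul_self, one_mul] at h1
    omega
  exact ⟨{
    rep := geomRep cs hM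
    form := F
    height := h
    root := β
    form_symm := hsymm
    form_pos := hpos
    form_inv := hinv
    rep_inj := fun w => geomRep_faithful cs hM
    root_unit := fun t ht => (hβ t ht).1
    rep_reflection := fun t ht => (hβ t ht).2.2
    height_root_pos := hh
    inversion_iff := hiff
    isReflection_of_rep := isReflection_of_geomRep cs hM hpos hinv
    length_eq_ncard := by
      intro w
      obtain ⟨ω, hω, rfl⟩ := cs.exists_isReduced w
      have h1 : {t | cs.IsLeftInversion (cs.wordProd ω) t} =
          ((cs.leftInvSeq ω).toFinset : Set W) := by
        ext t
        simp only [Set.mem_ofPred_eq, List.coe_toFinset]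
        exact ⟨fun ht => hmem ω t ht.1 ((hiff t ht.1 _).1 ht.2),
          cs.isLeftInversion_of_mem_leftInvSeq hω⟩
      rw [h1, Set.ncard_coe_finset, List.toFinset_card_of_nodup hω.nodup_leftInvSeq,
        cs.length_leftInvSeq]
      exact hω }⟩

end Construction

namespace RootModel

variable {B W V : Type*} [Group W] {M : CoxeterMatrix B} {cs : CoxeterSystem M W}
  [AddCommGroup V] [Module ℝ V] (R : RootModel cs V)

/-! ### Roots and coplanar reflections -/

theorem rep_mul_apply (x y : W) (v : V) : R.rep (x * y) v = R.rep x (R.rep y v) := by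
  rw [map_mul, Module.End.mul_apply]

theorem rep_inv_apply_self (x : W) (v : V) : R.rep x⁻¹ (R.rep x v) = v := by
  rw [← rep_mul_apply, inv_mul_cancel, map_one, Module.End.one_apply]

theorem rep_apply_inv_self (x : W) (v : V) : R.rep x (R.rep x⁻¹ v) = v := by
  rw [← rep_mul_apply, mul_inv_cancel, map_one, Module.End.one_apply]

theorem rep_root_self {t : W} (ht : cs.IsReflection t) : R.rep t (R.root t) = -R.root t := by
  rw [R.rep_reflection t ht, R.root_unit t ht]
  module

theorem eq_of_rep_eq {x y : W} (h : ∀ v, R.rep x v = R.rep y v) : x = y := by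
  have h1 : R.rep (x * y⁻¹) = 1 := by
    refine LinearMap.ext fun v => ?_
    rw [rep_mul_apply, h, rep_apply_inv_self, Module.End.one_apply]
  have h2 := R.rep_inj _ h1
  exact mul_inv_eq_one.1 h2

theorem root_ne_zero {t : W} (ht : cs.IsReflection t) : R.root t ≠ 0 := by
  intro h
  have := R.root_unit t ht
  rw [h] at this
  simp at this

/-- Roots of distinct reflections are linearly independent. -/
theorem root_indep {s t : W} (hs : cs.IsReflection s) (ht : cs.IsReflection t) (hst : s ≠ t)
    {a b : ℝ} (h : a • R.root s = b • R.root t) : a = 0 ∧ b = 0 := by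
  have hb : b = 0 ↔ a = 0 := by
    constructor
    · rintro rfl
      rw [zero_smul] at h
      exact (smul_eq_zero.1 h).resolve_right (R.root_ne_zero hs)
    · rintro rfl
      rw [zero_smul] at h
      exact (smul_eq_zero.1 h.symm).resolve_right (R.root_ne_zero ht)
  by_contra hne
  have ha0 : a ≠ 0 := fun h0 => hne ⟨h0, hb.2 h0⟩
  apply hst
  have h1 : R.root s = (a⁻¹ * b) • R.root t := by
    rw [mul_smul, ← h, smul_smul, inv_mul_cancel₀ ha0, one_smul]
  have h2 : (a⁻¹ * b) * (a⁻¹ * b) = 1 := by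
    have := R.root_unit s hs
    rw [h1] at this
    simpa [R.root_unit t ht] using this
  apply R.eq_of_rep_eq
  intro v
  rw [R.rep_reflection s hs, R.rep_reflection t ht, h1]
  generalize a⁻¹ * b = c at h2
  simp only [map_smul, LinearMap.smul_apply, smul_eq_mul, smul_smul]
  congr 2
  linear_combination 2 * R.form (R.root t) v * h2

theorem rep_root (w : W) {t : W} (ht : cs.IsReflection t) :
    R.rep w (R.root t) = R.root (w * t * w⁻¹) ∨ R.rep w (R.root t) = -R.root (w * t * w⁻¹) := by
  have ht' := ht.conj w
  have h1 := R.rep_reflection _ ht' (R.rep w (R.root t))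
  rw [rep_mul_apply, rep_inv_apply_self, rep_mul_apply, R.rep_root_self ht, map_neg] at h1
  set c := R.form (R.root (w * t * w⁻¹)) (R.rep w (R.root t))
  have h2 : R.rep w (R.root t) = c • R.root (w * t * w⁻¹) := by
    have h3 : (2 : ℝ) • R.rep w (R.root t) = (2 : ℝ) • c • R.root (w * t * w⁻¹) := by
      linear_combination (norm := module) (-1 : ℝ) • h1
    exact smul_right_injective _ two_ne_zero h3
  have h3 : c * c = 1 := by
    have := R.form_inv w (R.root t) (R.root t)
    rw [h2, R.root_unit t ht] at this
    simpa [R.root_unit _ ht'] using this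
  rcases mul_self_eq_one_iff.1 h3 with h | h
  · left; rw [h2, h, one_smul]
  · right; rw [h2, h, neg_one_smul]

theorem height_rep_root_ne_zero (w : W) {t : W} (ht : cs.IsReflection t) :
    R.height (R.rep w (R.root t)) ≠ 0 := by
  have := R.height_root_pos _ (ht.conj w)
  rcases R.rep_root w ht with h | h <;> rw [h]
  · exact this.ne'
  · rw [map_neg]; linarith

theorem lt_mul_iff {t : W} (ht : cs.IsReflection t) (w : W) :
    cs.length w < cs.length (t * w) ↔ 0 < R.height (R.rep w⁻¹ (R.root t)) := by
  have h1 := R.inversion_iff t ht w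
  have h2 := ht.length_mul_right_ne w
  have h3 := R.height_rep_root_ne_zero w⁻¹ ht
  constructor
  · intro h
    exact lt_of_le_of_ne (not_lt.1 fun h4 => by have := h1.2 h4; omega) h3.symm
  · intro h
    have : ¬ cs.length (t * w) < cs.length w := fun h4 => by have := h1.1 h4; linarith
    omega

theorem form_self_eq_zero {v : V} (h : R.form v v = 0) : v = 0 := by
  by_contra h0
  exact (R.form_pos v h0).ne' h

/-- Every vector has an orthogonal projection to the plane spanned by two distinct roots. -/
theorem exists_projection {p q : W} (hp : cs.IsReflection p) (hq : cs.IsReflection q)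
    (hpq : p ≠ q) (v : V) :
    ∃ a b : ℝ, R.form (R.root p) (v - a • R.root p - b • R.root q) = 0 ∧
      R.form (R.root q) (v - a • R.root p - b • R.root q) = 0 := by
  set c := R.form (R.root p) (R.root q) with hc
  have hc' : R.form (R.root q) (R.root p) = c := R.form_symm _ _
  have hd : 1 - c ^ 2 ≠ 0 := by
    intro h0
    have h1 : R.root q - c • R.root p = 0 := by
      apply R.form_self_eq_zero
      simp only [map_sub, map_smul, LinearMap.sub_apply, LinearMap.smul_apply, smul_eq_mul,
        R.root_unit p hp, R.root_unit q hq, ← hc, hc']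
      linear_combination h0
    have := (R.root_indep hq hp hpq.symm (a := 1) (b := c) (by
      rw [one_smul]; exact sub_eq_zero.1 h1)).1
    exact one_ne_zero this
  set x := R.form (R.root p) v
  set y := R.form (R.root q) v
  refine ⟨(x - c * y) / (1 - c ^ 2), (y - c * x) / (1 - c ^ 2), ?_, ?_⟩
  · simp only [map_sub, map_smul, smul_eq_mul, R.root_unit p hp, ← hc]
    change x - _ - _ = 0
    field_simp
    ring
  · simp only [map_sub, map_smul, smul_eq_mul, R.root_unit q hq, hc']
    change y - _ - _ = 0
    field_simp
    ring

/-- If `q p = q' p'` for reflections with `p ≠ p'`, then the root of `q` lies in the plane of the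
roots of `p` and `p'`: a vector orthogonal to that plane has the same image under `q` and `q'`,
hence is orthogonal to the root of `q`. -/
theorem root_mem_span {p p' q q' : W} (hp : cs.IsReflection p) (hp' : cs.IsReflection p')
    (hq : cs.IsReflection q) (hq' : cs.IsReflection q') (hne : p ≠ p') (h : q * p = q' * p') :
    R.root q ∈ Submodule.span ℝ {R.root p, R.root p'} := by
  have hqq : q ≠ q' := by
    rintro rfl
    exact hne (mul_left_cancel h)
  obtain ⟨a, b, h1, h2⟩ := R.exists_projection hp hp' hne (R.root q)
  set v := R.root q - a • R.root p - b • R.root p' with hv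
  have h3 : R.rep p v = v := by
    rw [R.rep_reflection p hp, h1]; module
  have h4 : R.rep p' v = v := by
    rw [R.rep_reflection p' hp', h2]; module
  have h5 : R.rep q v = R.rep q' v := by
    have := R.rep_mul_apply q p v
    rw [h, rep_mul_apply, h3, h4] at this
    exact this.symm
  rw [R.rep_reflection q hq, R.rep_reflection q' hq'] at h5
  have h6 := (R.root_indep hq hq' hqq (sub_right_injective h5)).1
  have h7 : R.form (R.root q) v = 0 := by linarith
  have h8 : v = 0 := by
    apply R.form_self_eq_zero
    have h9 : R.form v v = R.form (R.root q) v - a * R.form (R.root p) v -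
        b * R.form (R.root p') v := by
      simpa using congrArg (fun z => R.form z v) hv
    rw [h9, h1, h2, h7]
    ring
  rw [Submodule.mem_span_pair]
  exact ⟨a, b, by linear_combination (norm := module) (-1 : ℝ) • (hv.symm.trans h8)⟩

/-- An orthonormal basis of a plane in a root model. -/
structure Frame where
  /-- the first basis vector -/
  e₁ : V
  /-- the second basis vector -/
  e₂ : V
  form_one : R.form e₁ e₁ = 1
  form_two : R.form e₂ e₂ = 1
  form_one_two : R.form e₁ e₂ = 0

variable {R}

/-- The plane spanned by a frame. -/
def Frame.plane (E : R.Frame) : Submodule ℝ V := Submodule.span ℝ {E.e₁, E.e₂}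

/-- The reflections with root in the plane of a frame. -/
def Frame.refl (E : R.Frame) : Set W := {t | cs.IsReflection t ∧ R.root t ∈ E.plane}

theorem Frame.mem_plane (E : R.Frame) {v : V} :
    v ∈ E.plane ↔ ∃ x y : ℝ, v = x • E.e₁ + y • E.e₂ := by
  rw [Frame.plane, Submodule.mem_span_pair]
  simp only [eq_comm]

theorem Frame.form_two_one (E : R.Frame) : R.form E.e₂ E.e₁ = 0 := by
  rw [R.form_symm, E.form_one_two]

variable (R) in
theorem exists_frame {p q : W} (hp : cs.IsReflection p) (hq : cs.IsReflection q) (hpq : p ≠ q) :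
    ∃ E : R.Frame, p ∈ E.refl ∧ q ∈ E.refl := by
  set c := R.form (R.root p) (R.root q) with hc
  set f := R.root q - c • R.root p with hf
  have hf0 : f ≠ 0 := by
    intro h0
    have := (R.root_indep hq hp hpq.symm (a := 1) (b := c) (by
      rw [one_smul]; exact sub_eq_zero.1 h0)).1
    exact one_ne_zero this
  have hN := R.form_pos f hf0
  have hpf : R.form (R.root p) f = 0 := by
    simp only [hf, map_sub, map_smul, smul_eq_mul, R.root_unit p hp, ← hc]
    ring
  set k := (√(R.form f f))⁻¹ with hk
  have hs : √(R.form f f) ≠ 0 := (Real.sqrt_pos.2 hN).ne'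
  let E : R.Frame :=
    { e₁ := R.root p
      e₂ := k • f
      form_one := R.root_unit p hp
      form_two := by
        simp only [map_smul, LinearMap.smul_apply, smul_eq_mul]
        rw [← mul_assoc, hk, ← mul_inv, Real.mul_self_sqrt hN.le, inv_mul_cancel₀ hN.ne']
      form_one_two := by rw [map_smul, hpf, smul_zero] }
  refine ⟨E, ⟨hp, ?_⟩, hq, ?_⟩
  · exact E.mem_plane.2 ⟨1, 0, by module⟩
  · refine E.mem_plane.2 ⟨c, √(R.form f f), ?_⟩
    change _ = c • R.root p + √(R.form f f) • k • f
    rw [smul_smul, hk, mul_inv_cancel₀ hs, one_smul, hf]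
    module

namespace Frame

variable (E : R.Frame)

theorem exists_coord {t : W} (ht : t ∈ E.refl) :
    ∃ x y : ℝ, R.root t = x • E.e₁ + y • E.e₂ ∧ x ^ 2 + y ^ 2 = 1 := by
  obtain ⟨x, y, h⟩ := E.mem_plane.1 ht.2
  refine ⟨x, y, h, ?_⟩
  have := R.root_unit t ht.1
  rw [h] at this
  simp only [map_add, map_smul, LinearMap.add_apply, LinearMap.smul_apply, smul_eq_mul,
    E.form_one, E.form_two, E.form_one_two, E.form_two_one] at this
  linear_combination this

theorem rep_coord {t : W} (ht : t ∈ E.refl) {x y : ℝ} (h : R.root t = x • E.e₁ + y • E.e₂)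
    (hxy : x ^ 2 + y ^ 2 = 1) (v : V) (a b : ℝ) :
    R.rep t (v + a • E.e₁ + b • E.e₂) =
      v + ((y ^ 2 - x ^ 2) * (R.form E.e₁ v + a) - 2 * x * y * (R.form E.e₂ v + b) -
          R.form E.e₁ v) • E.e₁ +
        (-2 * x * y * (R.form E.e₁ v + a) + (x ^ 2 - y ^ 2) * (R.form E.e₂ v + b) -
          R.form E.e₂ v) • E.e₂ := by
  rw [R.rep_reflection t ht.1, h]
  simp only [map_add, map_smul, LinearMap.add_apply, LinearMap.smul_apply, smul_eq_mul,
    E.form_one, E.form_two, E.form_one_two, E.form_two_one]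
  set X := R.form E.e₁ v
  set Y := R.form E.e₂ v
  have h1 : (y ^ 2 - x ^ 2) * (X + a) - 2 * x * y * (Y + b) - X =
      a - 2 * (x * (X + a) + y * (Y + b)) * x := by linear_combination (X + a) * hxy
  have h2 : -2 * x * y * (X + a) + (x ^ 2 - y ^ 2) * (Y + b) - Y =
      b - 2 * (x * (X + a) + y * (Y + b)) * y := by linear_combination (Y + b) * hxy
  rw [h1, h2]
  module

/-- The product of three reflections with coplanar roots is a reflection with root in the same
plane. In complex coordinates on the plane its root is `z₁ z̄₂ z₃`. -/
theorem mul_mem {r s t : W} (hr : r ∈ E.refl) (hs : s ∈ E.refl) (ht : t ∈ E.refl) :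
    r * s * t ∈ E.refl := by
  obtain ⟨x₁, y₁, h₁, n₁⟩ := E.exists_coord hr
  obtain ⟨x₂, y₂, h₂, n₂⟩ := E.exists_coord hs
  obtain ⟨x₃, y₃, h₃, n₃⟩ := E.exists_coord ht
  obtain ⟨x, hx⟩ : ∃ x, x = (x₁ * x₂ + y₁ * y₂) * x₃ - (y₁ * x₂ - x₁ * y₂) * y₃ := ⟨_, rfl⟩
  obtain ⟨y, hy⟩ : ∃ y, y = (x₁ * x₂ + y₁ * y₂) * y₃ + (y₁ * x₂ - x₁ * y₂) * x₃ := ⟨_, rfl⟩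
  have hn : x ^ 2 + y ^ 2 = 1 := by
    have : x ^ 2 + y ^ 2 = (x₁ ^ 2 + y₁ ^ 2) * (x₂ ^ 2 + y₂ ^ 2) * (x₃ ^ 2 + y₃ ^ 2) := by
      rw [hx, hy]; ring
    rw [this, n₁, n₂, n₃]; norm_num
  set γ := x • E.e₁ + y • E.e₂ with hγ
  have hγ1 : R.form γ γ = 1 := by
    rw [hγ]
    simp only [map_add, map_smul, LinearMap.add_apply, LinearMap.smul_apply, smul_eq_mul,
      E.form_one, E.form_two, E.form_one_two, E.form_two_one]
    linear_combination hn
  have hrep : ∀ v, R.rep (r * s * t) v = v - (2 * R.form γ v) • γ := by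
    intro v
    have h0 : v = v + (0 : ℝ) • E.e₁ + (0 : ℝ) • E.e₂ := by module
    rw [rep_mul_apply, rep_mul_apply]
    conv_lhs => rw [h0]
    rw [E.rep_coord ht h₃ n₃, E.rep_coord hs h₂ n₂, E.rep_coord hr h₁ n₁, hγ]
    simp only [map_add, map_smul, LinearMap.add_apply, LinearMap.smul_apply, smul_eq_mul]
    set X := R.form E.e₁ v
    set Y := R.form E.e₂ v
    have e1 : v - (2 * (x * X + y * Y)) • (x • E.e₁ + y • E.e₂) =
        v + ((y ^ 2 - x ^ 2) * X - 2 * x * y * Y - X) • E.e₁ +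
          (-2 * x * y * X + (x ^ 2 - y ^ 2) * Y - Y) • E.e₂ := by
      have h1 : (y ^ 2 - x ^ 2) * X - 2 * x * y * Y - X = - (2 * (x * X + y * Y)) * x := by
        linear_combination X * hn
      have h2 : -2 * x * y * X + (x ^ 2 - y ^ 2) * Y - Y = - (2 * (x * X + y * Y)) * y := by
        linear_combination Y * hn
      rw [h1, h2]
      module
    rw [e1, hx, hy]
    congr 2
    · congr 1
      ring
    · congr 1
      ring
  have hrefl := R.isReflection_of_rep _ γ hγ1 hrep
  refine ⟨hrefl, ?_⟩
  have h1 := R.rep_reflection _ hrefl (R.root (r * s * t))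
  rw [hrep, R.root_unit _ hrefl] at h1
  have h2 : R.root (r * s * t) = R.form γ (R.root (r * s * t)) • γ := by
    have h3 : (2 : ℝ) • R.root (r * s * t) = (2 : ℝ) • R.form γ (R.root (r * s * t)) • γ := by
      linear_combination (norm := module) (1 : ℝ) • h1
    exact smul_right_injective _ two_ne_zero h3
  rw [h2, hγ]
  exact E.mem_plane.2 ⟨R.form γ (R.root (r * s * t)) * x, R.form γ (R.root (r * s * t)) * y,
    by rw [hγ]; module⟩

theorem span_le {p q : W} (hp : p ∈ E.refl) (hq : q ∈ E.refl) :
    Submodule.span ℝ {R.root p, R.root q} ≤ E.plane := by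
  rw [Submodule.span_le]
  rintro v (rfl | rfl)
  · exact hp.2
  · exact hq.2

end Frame

variable (R) in
/-- If `q p = q' p'` with `p ≠ p'`, then every frame whose plane contains the roots of `p` and
`p'` also contains the root of `q`. -/
theorem mem_refl_of_mul_eq (E : R.Frame) {p p' q q' : W} (hp : p ∈ E.refl) (hp' : p' ∈ E.refl)
    (hq : cs.IsReflection q) (hq' : cs.IsReflection q') (hne : p ≠ p') (h : q * p = q' * p') :
    q ∈ E.refl :=
  ⟨hq, E.span_le hp hp' (R.root_mem_span hp.1 hp'.1 hq hq' hne h)⟩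

end RootModel

section Hexagon

variable {B W : Type*} [Group W] {M : CoxeterMatrix B} {cs : CoxeterSystem M W}

theorem isReflection_mul_inv_of_adj {x y : W} (h : (bruhatGraph cs).Adj x y) :
    cs.IsReflection (y * x⁻¹) := by
  rcases h with ⟨⟨t, ht, rfl⟩, -⟩ | ⟨⟨t, ht, rfl⟩, -⟩
  · simpa using ht
  · simpa [mul_assoc, ht.inv] using ht

theorem adj_iff_isReflection {x y : W} :
    (bruhatGraph cs).Adj x y ↔ cs.IsReflection (y * x⁻¹) := by
  refine ⟨isReflection_mul_inv_of_adj, fun h => ?_⟩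
  have h1 := h.length_mul_right_ne x
  rw [inv_mul_cancel_right] at h1
  rcases lt_or_gt_of_ne h1 with h2 | h2
  · exact Or.inr ⟨⟨y * x⁻¹, h, (mul_inv_eq_one.1 (by rw [← h.mul_self]; group)).symm⟩, h2⟩
  · exact Or.inl ⟨⟨y * x⁻¹, h, by simp⟩, h2⟩

/-- Two paths of length three with all eight possible edges between consecutive layers: then all
reflections involved have coplanar roots, and the end points are adjacent. -/
theorem adj_of_hexagon {V : Type*} [AddCommGroup V] [Module ℝ V] (R : RootModel cs V)
    {x a₁ a₂ b₁ b₂ y : W} (ha : a₁ ≠ a₂) (hb : b₁ ≠ b₂)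
    (xa₁ : (bruhatGraph cs).Adj x a₁) (xa₂ : (bruhatGraph cs).Adj x a₂)
    (ab₁₁ : (bruhatGraph cs).Adj a₁ b₁) (ab₂₁ : (bruhatGraph cs).Adj a₂ b₁)
    (ab₁₂ : (bruhatGraph cs).Adj a₁ b₂) (ab₂₂ : (bruhatGraph cs).Adj a₂ b₂)
    (by₁ : (bruhatGraph cs).Adj b₁ y) (by₂ : (bruhatGraph cs).Adj b₂ y) :
    (bruhatGraph cs).Adj x y := by
  rw [adj_iff_isReflection] at *
  obtain ⟨E, h1, h2⟩ := R.exists_frame xa₁ xa₂ (fun h => ha (mul_right_cancel h))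
  have hne1 : a₁ * x⁻¹ ≠ a₂ * x⁻¹ := fun h => ha (mul_right_cancel h)
  have hne2 : b₁ * a₁⁻¹ ≠ b₂ * a₁⁻¹ := fun h => hb (mul_right_cancel h)
  have h3 := R.mem_refl_of_mul_eq E h1 h2 ab₁₁ ab₂₁ hne1 (by group)
  have h4 := R.mem_refl_of_mul_eq E h1 h2 ab₁₂ ab₂₂ hne1 (by group)
  have h5 := R.mem_refl_of_mul_eq E h3 h4 by₁ by₂ hne2 (by group)
  have h6 := E.mul_mem h5 h3 h1
  have : y * b₁⁻¹ * (b₁ * a₁⁻¹) * (a₁ * x⁻¹) = y * x⁻¹ := by group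
  rw [this] at h6
  exact h6.1

end Hexagon

section Inversions

variable {B W : Type*} [Group W] {M : CoxeterMatrix B} (cs : CoxeterSystem M W)

/-! ### Inversions in a set of reflections -/

/-- The left inversions of `z` that lie in `A`. -/
def inversionsIn (A : Set W) (z : W) : Set W := {s | s ∈ A ∧ cs.length (s * z) < cs.length z}

end Inversions

namespace RootModel

variable {B W V : Type*} [Group W] {M : CoxeterMatrix B} {cs : CoxeterSystem M W}
  [AddCommGroup V] [Module ℝ V] (R : RootModel cs V)

theorem rep_root_of_pos {s t : W} (hs : cs.IsReflection s)
    (h : 0 < R.height (R.rep t (R.root s))) : R.rep t (R.root s) = R.root (t * s * t⁻¹) := by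
  refine (R.rep_root t hs).resolve_right fun h1 => ?_
  rw [h1, map_neg] at h
  linarith [R.height_root_pos _ (hs.conj t)]

theorem rep_root_of_neg {s t : W} (hs : cs.IsReflection s)
    (h : R.height (R.rep t (R.root s)) < 0) : R.rep t (R.root s) = -R.root (t * s * t⁻¹) := by
  refine (R.rep_root t hs).resolve_left fun h1 => ?_
  rw [h1] at h
  linarith [R.height_root_pos _ (hs.conj t)]

theorem rep_mul_inv_apply {t : W} (ht : cs.IsReflection t) (x : W) (v : V) :
    R.rep (t * x)⁻¹ v = R.rep x⁻¹ (R.rep t v) := by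
  rw [mul_inv_rev, ht.inv, rep_mul_apply]

theorem rep_rep_self {t : W} (ht : cs.IsReflection t) (v : V) : R.rep t (R.rep t v) = v := by
  rw [← rep_mul_apply, ht.mul_self, map_one, Module.End.one_apply]

open Classical in
/-- The map `s ↦ t s t` if `t` keeps the root of `s` positive, and `s ↦ s` otherwise. If
`x < t x` it embeds the inversions of `x` into those of `t x`. -/
noncomputable def transfer (t s : W) : W :=
  if 0 < R.height (R.rep t (R.root s)) then t * s * t⁻¹ else s

variable {R}

theorem transfer_of_pos {t s : W} (h : 0 < R.height (R.rep t (R.root s))) :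
    R.transfer t s = t * s * t⁻¹ := if_pos h

theorem transfer_of_neg {t s : W} (h : R.height (R.rep t (R.root s)) < 0) :
    R.transfer t s = s := if_neg h.not_gt

variable (R) in
/-- If `t` keeps the root of `s` positive, then it keeps the root of `t s t` positive. -/
theorem height_rep_root_conj {s t : W} (hs : cs.IsReflection s) (ht : cs.IsReflection t)
    (h : 0 < R.height (R.rep t (R.root s))) :
    0 < R.height (R.rep t (R.root (t * s * t⁻¹))) := by
  rw [← R.rep_root_of_pos hs h, R.rep_rep_self ht]
  exact R.height_root_pos s hs

theorem transfer_injOn {t : W} (ht : cs.IsReflection t) :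
    Set.InjOn (R.transfer t) {s | cs.IsReflection s} := by
  intro s hs s' hs' h
  rcases lt_or_gt_of_ne (R.height_rep_root_ne_zero t hs) with h1 | h1 <;>
    rcases lt_or_gt_of_ne (R.height_rep_root_ne_zero t hs') with h2 | h2
  · rwa [transfer_of_neg h1, transfer_of_neg h2] at h
  · rw [transfer_of_neg h1, transfer_of_pos h2] at h
    have := R.height_rep_root_conj hs' ht h2
    rw [← h] at this
    linarith
  · rw [transfer_of_pos h1, transfer_of_neg h2] at h
    have := R.height_rep_root_conj hs ht h1
    rw [h] at this
    linarith
  · rw [transfer_of_pos h1, transfer_of_pos h2] at h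
    exact mul_left_cancel (mul_right_cancel h)

theorem transfer_eq_self_iff {t : W} (ht : cs.IsReflection t) {s : W} (hs : cs.IsReflection s) :
    R.transfer t s = t ↔ s = t := by
  have h0 : R.transfer t t = t := transfer_of_neg (by
    rw [R.rep_root_self ht, map_neg]; linarith [R.height_root_pos t ht])
  constructor
  · intro h
    exact transfer_injOn ht hs ht (h.trans h0.symm)
  · rintro rfl
    exact h0

variable {A : Set W} {t x : W}

theorem transfer_mem (hA : ∀ s ∈ A, cs.IsReflection s) (ht : cs.IsReflection t)
    (hc : ∀ s ∈ A, t * s * t⁻¹ ∈ A) (hx : cs.length x < cs.length (t * x)) {s : W}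
    (hs : s ∈ inversionsIn cs A x) : R.transfer t s ∈ inversionsIn cs A (t * x) := by
  have hs' := hA s hs.1
  have h0 := (R.inversion_iff s hs' x).1 hs.2
  rcases lt_or_gt_of_ne (R.height_rep_root_ne_zero t hs') with h1 | h1
  · rw [transfer_of_neg h1]
    refine ⟨hs.1, (R.inversion_iff s hs' _).2 ?_⟩
    have h2 := (R.lt_mul_iff ht x).1 hx
    rw [R.rep_mul_inv_apply ht]
    rw [R.rep_reflection t ht] at h1 ⊢
    simp only [map_sub, map_smul, smul_eq_mul] at h1 ⊢
    have h3 := R.height_root_pos s hs'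
    have h4 := R.height_root_pos t ht
    have h5 : 0 < R.form (R.root t) (R.root s) := by
      by_contra h6
      nlinarith
    nlinarith
  · rw [transfer_of_pos h1]
    have hr := hA _ (hc s hs.1)
    refine ⟨hc s hs.1, (R.inversion_iff _ hr _).2 ?_⟩
    rw [R.rep_mul_inv_apply ht, ← R.rep_root_of_pos hs' h1, R.rep_rep_self ht]
    exact h0

theorem self_mem_inversionsIn (ht : cs.IsReflection t) (htA : t ∈ A)
    (hx : cs.length x < cs.length (t * x)) : t ∈ inversionsIn cs A (t * x) := by
  refine ⟨htA, ?_⟩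
  rwa [← mul_assoc, ht.mul_self, one_mul]

theorem self_notMem_transfer (hA : ∀ s ∈ A, cs.IsReflection s) (ht : cs.IsReflection t)
    (hx : cs.length x < cs.length (t * x)) : t ∉ R.transfer t '' inversionsIn cs A x := by
  rintro ⟨s, hs, h⟩
  rw [transfer_eq_self_iff ht (hA s hs.1)] at h
  rw [h] at hs
  exact absurd hs.2 (by omega)

theorem ncard_transfer_image (hA : ∀ s ∈ A, cs.IsReflection s) (ht : cs.IsReflection t) :
    (R.transfer t '' inversionsIn cs A x).ncard = (inversionsIn cs A x).ncard :=
  ((transfer_injOn ht).mono fun s hs => hA s hs.1).ncard_image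

variable [Finite W]

theorem ncard_inversionsIn_lt (R : RootModel cs V)
    (hA : ∀ s ∈ A, cs.IsReflection s) (htA : t ∈ A)
    (hc : ∀ s ∈ A, t * s * t⁻¹ ∈ A) (hx : cs.length x < cs.length (t * x)) :
    (inversionsIn cs A x).ncard < (inversionsIn cs A (t * x)).ncard := by
  have ht := hA t htA
  rw [← ncard_transfer_image (R := R) hA ht, Nat.lt_iff_add_one_le,
    ← Set.ncard_insert_of_notMem (self_notMem_transfer hA ht hx)]
  refine Set.ncard_le_ncard ?_ (Set.toFinite _)
  rw [Set.insert_subset_iff]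
  refine ⟨self_mem_inversionsIn ht htA hx, ?_⟩
  rintro _ ⟨s, hs, rfl⟩
  exact transfer_mem hA ht hc hx hs

theorem exists_new_inversion (R : RootModel cs V)
    (hA : ∀ s ∈ A, cs.IsReflection s) (htA : t ∈ A)
    (hc : ∀ s ∈ A, t * s * t⁻¹ ∈ A)
    (h : (inversionsIn cs A x).ncard + 1 < (inversionsIn cs A (t * x)).ncard) :
    ∃ r ∈ A, r ≠ t ∧ R.height (R.rep t (R.root r)) < 0 ∧ cs.length x < cs.length (r * x) ∧
      cs.length (r * (t * x)) < cs.length (t * x) := by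
  have ht := hA t htA
  obtain ⟨r, hr, hr'⟩ : ∃ r ∈ inversionsIn cs A (t * x),
      r ∉ insert t (R.transfer t '' inversionsIn cs A x) := by
    by_contra! hsub
    have h1 := Set.ncard_le_ncard hsub
    have h2 := Set.ncard_insert_le t (R.transfer t '' inversionsIn cs A x)
    rw [ncard_transfer_image hA ht] at h2
    omega
  rw [Set.mem_insert_iff, not_or] at hr'
  have hrr := hA r hr.1
  have h0 := (R.inversion_iff r hrr _).1 hr.2
  rw [R.rep_mul_inv_apply ht] at h0
  have hneg : R.height (R.rep t (R.root r)) < 0 := by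
    refine lt_of_le_of_ne (not_lt.1 fun hpos => hr'.2 ?_) (R.height_rep_root_ne_zero t hrr)
    have hcA := hc r hr.1
    refine ⟨t * r * t⁻¹, ⟨hcA, (R.inversion_iff _ (hA _ hcA) _).2 ?_⟩, ?_⟩
    · rwa [← R.rep_root_of_pos hrr hpos]
    · rw [transfer_of_pos (R.height_rep_root_conj hrr ht hpos), ht.inv]
      simp only [← mul_assoc, ht.mul_self, one_mul]
      rw [mul_assoc, ht.mul_self, mul_one]
  refine ⟨r, hr.1, hr'.1, hneg, ?_, hr.2⟩
  have h1 : ¬ cs.length (r * x) < cs.length x := fun h2 =>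
    hr'.2 ⟨r, ⟨hr.1, h2⟩, transfer_of_neg hneg⟩
  have := hrr.length_mul_right_ne x
  omega

theorem ncard_inversionsIn_add_three_le (R : RootModel cs V)
    (hA : ∀ s ∈ A, cs.IsReflection s) (htA : t ∈ A)
    (hc : ∀ s ∈ A, t * s * t⁻¹ ∈ A) (hx : cs.length x < cs.length (t * x)) {r : W} (hrA : r ∈ A)
    (hrt : r ≠ t) (hneg : R.height (R.rep t (R.root r)) < 0)
    (hrx : cs.length x < cs.length (r * x))
    (hrtx : cs.length (r * (t * x)) < cs.length (t * x)) :
    (inversionsIn cs A x).ncard + 3 ≤ (inversionsIn cs A (t * x)).ncard := by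
  have ht := hA t htA
  have hr := hA r hrA
  have hr'A := hc r hrA
  obtain ⟨r', hr'⟩ : ∃ r', r' = t * r * t⁻¹ := ⟨_, rfl⟩
  rw [← hr'] at hr'A
  have hr'r := hA _ hr'A
  have h1 : R.rep t (R.root r) = -R.root r' := by
    rw [hr']; exact R.rep_root_of_neg hr hneg
  have h2 : R.rep t (R.root r') = -R.root r := by
    have := R.rep_rep_self ht (R.root r)
    rw [h1, map_neg] at this
    rw [← this, neg_neg]
  have hneg' : R.height (R.rep t (R.root r')) < 0 := by
    rw [h2, map_neg]; linarith [R.height_root_pos r hr]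
  have hrr' : r ≠ r' := by
    intro h
    rw [← h, R.rep_reflection t ht] at h1
    have h3 := (R.root_indep hr ht hrt (a := 2) (b := 2 * R.form (R.root t) (R.root r)) (by
      linear_combination (norm := module) (1 : ℝ) • h1)).1
    exact two_ne_zero h3
  have hr't : r' ≠ t := by
    intro h
    rw [h, R.rep_root_self ht] at h2
    have := R.root_indep ht hr hrt.symm (a := 1) (b := 1)
      (by rw [one_smul, one_smul]; exact neg_injective h2)
    exact one_ne_zero this.1
  have e1 := (R.lt_mul_iff hr x).1 hrx
  have e2 := (R.inversion_iff r hr _).1 hrtx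
  rw [R.rep_mul_inv_apply ht, h1, map_neg, map_neg] at e2
  have hr'x : cs.length x < cs.length (r' * x) := (R.lt_mul_iff hr'r x).2 (by linarith)
  have hr'tx : cs.length (r' * (t * x)) < cs.length (t * x) := by
    rw [R.inversion_iff r' hr'r, R.rep_mul_inv_apply ht, h2, map_neg, map_neg]
    linarith
  have hnot : ∀ r, cs.IsReflection r → R.height (R.rep t (R.root r)) < 0 →
      cs.length x < cs.length (r * x) → r ∉ R.transfer t '' inversionsIn cs A x := by
    rintro r hr hneg hrx ⟨s, hs, h⟩
    have hs' := hA s hs.1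
    rcases lt_or_gt_of_ne (R.height_rep_root_ne_zero t hs') with h1 | h1
    · rw [transfer_of_neg h1] at h
      rw [h] at hs
      exact absurd hs.2 (by omega)
    · rw [transfer_of_pos h1] at h
      have := R.height_rep_root_conj hs' ht h1
      rw [h] at this
      linarith
  have hcard : (insert t (insert r (insert r' (R.transfer t '' inversionsIn cs A x)))).ncard =
      (inversionsIn cs A x).ncard + 3 := by
    rw [Set.ncard_insert_of_notMem, Set.ncard_insert_of_notMem, Set.ncard_insert_of_notMem,
      ncard_transfer_image hA ht]
    · exact hnot r' hr'r hneg' hr'x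
    · rw [Set.mem_insert_iff, not_or]
      exact ⟨hrr', hnot r hr hneg hrx⟩
    · rw [Set.mem_insert_iff, Set.mem_insert_iff, not_or, not_or]
      exact ⟨hrt.symm, hr't.symm, self_notMem_transfer hA ht hx⟩
  rw [← hcard]
  refine Set.ncard_le_ncard ?_ (Set.toFinite _)
  simp only [Set.insert_subset_iff]
  refine ⟨self_mem_inversionsIn ht htA hx, ⟨hrA, hrtx⟩, ⟨hr'A, hr'tx⟩, ?_⟩
  rintro _ ⟨s, hs, rfl⟩
  exact transfer_mem hA ht hc hx hs

end RootModel

/-! ### Cosets of dihedral reflection subgroups -/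

namespace RootModel.Frame

variable {B W V : Type*} [Group W] {M : CoxeterMatrix B} {cs : CoxeterSystem M W}
  [AddCommGroup V] [Module ℝ V] {R : RootModel cs V} (E : R.Frame)

/-- The number of left inversions of `z` with root in the plane of the frame. -/
noncomputable def rank (z : W) : ℕ := (inversionsIn cs E.refl z).ncard

/-- The elements `s x` for `s` a reflection with root in the plane. -/
def oddCoset (x : W) : Set W := {z | z * x⁻¹ ∈ E.refl}

/-- The elements `s s' x` for `s`, `s'` reflections with root in the plane. -/
def evenCoset (x : W) : Set W := {z | ∃ s ∈ E.refl, ∃ s' ∈ E.refl, z = s * s' * x}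

variable {E}

theorem mul_self_of_mem {s : W} (hs : s ∈ E.refl) : s * s = 1 := hs.1.mul_self

theorem inv_of_mem {s : W} (hs : s ∈ E.refl) : s⁻¹ = s := hs.1.inv

theorem conj_mem {s t : W} (hs : s ∈ E.refl) (ht : t ∈ E.refl) : t * s * t⁻¹ ∈ E.refl := by
  rw [inv_of_mem ht]
  exact E.mul_mem ht hs ht

theorem mul_mem_oddCoset {s : W} (hs : s ∈ E.refl) (x : W) : s * x ∈ E.oddCoset x := by
  simpa [oddCoset] using hs

theorem exists_of_mem_oddCoset {x z : W} (h : z ∈ E.oddCoset x) : ∃ s ∈ E.refl, z = s * x :=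
  ⟨z * x⁻¹, h, by simp⟩

theorem oddCoset_comm {x z : W} (h : z ∈ E.oddCoset x) : x ∈ E.oddCoset z := by
  obtain ⟨s, hs, rfl⟩ := exists_of_mem_oddCoset h
  simpa [oddCoset, inv_of_mem hs] using hs

theorem oddCoset_of_evenCoset {x y z : W} (hz : z ∈ E.evenCoset y) (hy : y ∈ E.oddCoset x) :
    z ∈ E.oddCoset x := by
  obtain ⟨s, hs, s', hs', rfl⟩ := hz
  obtain ⟨t, ht, rfl⟩ := exists_of_mem_oddCoset hy
  rw [← mul_assoc]
  exact mul_mem_oddCoset (E.mul_mem hs hs' ht) x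

theorem evenCoset_of_oddCoset {x y z : W} (hz : z ∈ E.oddCoset y) (hy : y ∈ E.oddCoset x) :
    z ∈ E.evenCoset x := by
  obtain ⟨s, hs, rfl⟩ := exists_of_mem_oddCoset hz
  obtain ⟨t, ht, rfl⟩ := exists_of_mem_oddCoset hy
  exact ⟨s, hs, t, ht, by rw [mul_assoc]⟩

theorem evenCoset_comm {x z : W} (h : z ∈ E.evenCoset x) : x ∈ E.evenCoset z := by
  obtain ⟨s, hs, t, ht, rfl⟩ := h
  refine ⟨t, ht, s, hs, ?_⟩
  rw [← mul_assoc, ← mul_assoc, mul_assoc t, mul_self_of_mem hs, mul_one, mul_self_of_mem ht,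
    one_mul]

theorem oddCoset_eq_of_evenCoset {x z : W} (h : z ∈ E.evenCoset x) :
    E.oddCoset z = E.oddCoset x := by
  ext y
  exact ⟨fun hy => oddCoset_comm (oddCoset_of_evenCoset (evenCoset_comm h) (oddCoset_comm hy)),
    fun hy => oddCoset_comm (oddCoset_of_evenCoset h (oddCoset_comm hy))⟩

/-- Up to sign, the reflections of the plane permute the roots of the plane. -/
theorem rep_root_mem {r s : W} (hr : r ∈ E.refl) (hs : s ∈ E.refl) {v : V}
    (hv : v = R.root r ∨ v = -R.root r) :
    ∃ r' ∈ E.refl, R.rep s v = R.root r' ∨ R.rep s v = -R.root r' := by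
  refine ⟨_, conj_mem hr hs, ?_⟩
  rcases R.rep_root s hr.1 with h | h <;> rcases hv with rfl | rfl <;> simp [h]

variable (E) in
/-- Order the reflections of the plane by the slope of their positive roots. The inversions of an
element are cut out by an affine inequality in the slope. -/
theorem exists_slope : ∃ σ : W → ℝ, ∀ z, ∃ c d : ℝ, ∀ s ∈ E.refl,
    s ∈ inversionsIn cs E.refl z ↔ c + d * σ s < 0 := by
  set p := R.height E.e₁
  set q := R.height E.e₂
  set x : W → ℝ := fun s => R.form E.e₁ (R.root s)
  set y : W → ℝ := fun s => R.form E.e₂ (R.root s)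
  have hroot : ∀ s ∈ E.refl, R.root s = x s • E.e₁ + y s • E.e₂ := by
    intro s hs
    obtain ⟨a, b, h, -⟩ := E.exists_coord hs
    have hx : x s = a := by simp [x, h, E.form_one, E.form_one_two]
    have hy : y s = b := by simp [y, h, E.form_two, E.form_two_one]
    rw [hx, hy, h]
  refine ⟨fun s => (y s * p - x s * q) / (x s * p + y s * q), fun z => ?_⟩
  set a := R.height (R.rep z⁻¹ E.e₁)
  set b := R.height (R.rep z⁻¹ E.e₂)
  refine ⟨a * p + b * q, b * p - a * q, fun s hs => ?_⟩
  have hh : 0 < x s * p + y s * q := by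
    have := R.height_root_pos s hs.1
    rw [hroot s hs] at this
    simpa using this
  have hX : R.height (R.rep z⁻¹ (R.root s)) = a * x s + b * y s := by
    rw [hroot s hs]
    simp only [map_add, map_smul, smul_eq_mul]
    ring
  have hD : 0 < p ^ 2 + q ^ 2 := by
    by_contra h0
    have hp : p = 0 := by nlinarith [sq_nonneg p, sq_nonneg q]
    have hq : q = 0 := by nlinarith [sq_nonneg p, sq_nonneg q]
    rw [hp, hq] at hh
    simp at hh
  have hh0 := hh.ne'
  have key : a * p + b * q + (b * p - a * q) * ((y s * p - x s * q) / (x s * p + y s * q)) =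
      (a * x s + b * y s) * ((p ^ 2 + q ^ 2) / (x s * p + y s * q)) := by
    rw [← mul_div_assoc, ← mul_div_assoc, eq_div_iff hh0, add_mul, div_mul_cancel₀ _ hh0]
    ring
  simp only [inversionsIn, Set.mem_ofPred_eq, hs, true_and]
  rw [R.inversion_iff s hs.1, hX, key]
  constructor
  · intro h; exact mul_neg_of_neg_of_pos h (div_pos hD hh)
  · intro h; exact neg_of_mul_neg_left h (div_pos hD hh).le

variable [Finite W]

theorem rank_lt_of_length_lt {x z : W} (h : z ∈ E.oddCoset x) (hl : cs.length x < cs.length z) :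
    E.rank x < E.rank z := by
  obtain ⟨s, hs, rfl⟩ := exists_of_mem_oddCoset h
  exact R.ncard_inversionsIn_lt (fun s hs => hs.1) hs (fun r hr => conj_mem hr hs) hl

theorem length_lt_of_rank_lt {x z : W} (h : z ∈ E.oddCoset x) (hr : E.rank x < E.rank z) :
    cs.length x < cs.length z := by
  by_contra hl
  have h1 : cs.length z ≠ cs.length x := by
    obtain ⟨s, hs, rfl⟩ := exists_of_mem_oddCoset h
    exact hs.1.length_mul_right_ne x
  have := rank_lt_of_length_lt (oddCoset_comm h) (by omega)
  omega

theorem rank_ne_of_oddCoset {x z : W} (h : z ∈ E.oddCoset x) : E.rank z ≠ E.rank x := by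
  have h1 : cs.length z ≠ cs.length x := by
    obtain ⟨s, hs, rfl⟩ := exists_of_mem_oddCoset h
    exact hs.1.length_mul_right_ne x
  rcases lt_or_gt_of_ne h1 with h2 | h2
  · exact (rank_lt_of_length_lt (oddCoset_comm h) h2).ne
  · exact (rank_lt_of_length_lt h h2).ne'

theorem bruhatStep_of_rank_lt {x z : W} (h : z ∈ E.oddCoset x) (hr : E.rank x < E.rank z) :
    BruhatStep cs x z := by
  refine ⟨?_, length_lt_of_rank_lt h hr⟩
  obtain ⟨s, hs, rfl⟩ := exists_of_mem_oddCoset h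
  exact ⟨s, hs.1, rfl⟩

theorem rank_le (z : W) : E.rank z ≤ E.refl.ncard :=
  Set.ncard_le_ncard (fun _ hs => hs.1) (Set.toFinite _)

/-- The rank counts the elements of lower rank in the opposite class. -/
theorem ncard_oddCoset_rank_lt (z : W) :
    {o | o ∈ E.oddCoset z ∧ E.rank o < E.rank z}.ncard = E.rank z := by
  have h1 : {o | o ∈ E.oddCoset z ∧ E.rank o < E.rank z} =
      (fun s => s * z) '' inversionsIn cs E.refl z := by
    ext o
    constructor
    · rintro ⟨ho, hr⟩
      have hl := length_lt_of_rank_lt (oddCoset_comm ho) hr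
      obtain ⟨s, hs, rfl⟩ := exists_of_mem_oddCoset ho
      exact ⟨s, ⟨hs, hl⟩, rfl⟩
    · rintro ⟨s, hs, rfl⟩
      have ho := mul_mem_oddCoset hs.1 z
      exact ⟨ho, rank_lt_of_length_lt (oddCoset_comm ho) hs.2⟩
  rw [h1, Set.ncard_image_of_injective _ (mul_left_injective z)]
  rfl

/-- Consecutive ranks belong to opposite classes. -/
theorem rank_ne_succ_of_evenCoset {x z : W} (h : z ∈ E.evenCoset x) :
    E.rank z ≠ E.rank x + 1 := by
  intro hr
  have h1 := ncard_oddCoset_rank_lt (E := E) z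
  have h2 := ncard_oddCoset_rank_lt (E := E) x
  have h3 : {o | o ∈ E.oddCoset z ∧ E.rank o < E.rank z} =
      {o | o ∈ E.oddCoset x ∧ E.rank o < E.rank x} := by
    rw [oddCoset_eq_of_evenCoset h, hr]
    ext o
    refine and_congr_right fun ho => ?_
    have := rank_ne_of_oddCoset ho
    omega
  rw [h3, h2] at h1
  omega

/-- An element `z` is determined within its class by its inversions in the plane: if `z` and
`g z`, with `g` a rotation of the plane, have the same inversions, then averaging over the powers
of `g` a root on which `z⁻¹` is positive gives a nonzero vector of the plane fixed by `g`. -/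
theorem eq_of_inversionsIn_eq {s₁ s₂ z : W} (h₁ : s₁ ∈ E.refl) (h₂ : s₂ ∈ E.refl)
    (h : inversionsIn cs E.refl (s₁ * s₂ * z) = inversionsIn cs E.refl z) : s₁ = s₂ := by
  by_contra hne
  set k := s₂ * s₁ with hk
  have hkinv : (s₁ * s₂)⁻¹ = k := by rw [mul_inv_rev, inv_of_mem h₁, inv_of_mem h₂]
  let X : V →ₗ[ℝ] ℝ := R.height ∘ₗ R.rep z⁻¹
  have hX : ∀ v, X v = R.height (R.rep z⁻¹ v) := fun v => rfl
  have hiff : ∀ s ∈ E.refl, X (R.root s) < 0 ↔ X (R.rep k (R.root s)) < 0 := by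
    intro s hs
    have h3 : s ∈ inversionsIn cs E.refl (s₁ * s₂ * z) ↔ s ∈ inversionsIn cs E.refl z := by
      rw [h]
    simp only [inversionsIn, Set.mem_ofPred_eq, hs, true_and, R.inversion_iff s hs.1] at h3
    rw [mul_inv_rev, hkinv, rep_mul_apply] at h3
    exact h3.symm
  have hgood : ∀ v, (∃ r ∈ E.refl, v = R.root r ∨ v = -R.root r) →
      ∃ r ∈ E.refl, R.rep k v = R.root r ∨ R.rep k v = -R.root r := by
    rintro v ⟨r, hr, hv⟩
    obtain ⟨r', hr', hv'⟩ := rep_root_mem hr h₁ hv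
    rw [hk, rep_mul_apply]
    exact rep_root_mem hr' h₂ hv'
  have hne0 : ∀ v, (∃ r ∈ E.refl, v = R.root r ∨ v = -R.root r) → X v ≠ 0 := by
    rintro v ⟨r, hr, rfl | rfl⟩
    · exact R.height_rep_root_ne_zero _ hr.1
    · rw [map_neg, neg_ne_zero]
      exact R.height_rep_root_ne_zero _ hr.1
  have hstep : ∀ v, (∃ r ∈ E.refl, v = R.root r ∨ v = -R.root r) → 0 < X v →
      0 < X (R.rep k v) := by
    intro v hv hpos
    have h0 := hne0 _ (hgood v hv)
    obtain ⟨r, hr, rfl | rfl⟩ := hv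
    · have := hiff r hr
      exact lt_of_le_of_ne (not_lt.1 fun h5 => by linarith [this.2 h5]) h0.symm
    · rw [map_neg] at hpos
      rw [map_neg, map_neg]
      have := (hiff r hr).1 (by linarith)
      linarith
  obtain ⟨v, hv, hvpos, hvspan⟩ : ∃ v, (∃ r ∈ E.refl, v = R.root r ∨ v = -R.root r) ∧ 0 < X v ∧
      v ∈ Submodule.span ℝ {R.root s₁, R.root s₂} := by
    have hm : R.root s₁ ∈ Submodule.span ℝ {R.root s₁, R.root s₂} :=
      Submodule.subset_span (by simp)
    rcases lt_or_gt_of_ne (hne0 (R.root s₁) ⟨s₁, h₁, Or.inl rfl⟩) with h0 | h0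
    · exact ⟨-R.root s₁, ⟨s₁, h₁, Or.inr rfl⟩, by rw [map_neg]; linarith, neg_mem hm⟩
    · exact ⟨R.root s₁, ⟨s₁, h₁, Or.inl rfl⟩, h0, hm⟩
  have hpow : ∀ n : ℕ, (∃ r ∈ E.refl, R.rep (k ^ n) v = R.root r ∨ R.rep (k ^ n) v = -R.root r) ∧
      0 < X (R.rep (k ^ n) v) ∧
      R.rep (k ^ n) v ∈ Submodule.span ℝ {R.root s₁, R.root s₂} := by
    intro n
    induction n with
    | zero => simpa using ⟨hv, hvpos, hvspan⟩
    | succ n ih =>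
      rw [pow_succ', rep_mul_apply]
      refine ⟨hgood _ ih.1, hstep _ ih.1 ih.2.1, ?_⟩
      rw [hk, rep_mul_apply, R.rep_reflection s₂ h₂.1, R.rep_reflection s₁ h₁.1]
      have m1 : R.root s₁ ∈ Submodule.span ℝ {R.root s₁, R.root s₂} :=
        Submodule.subset_span (by simp)
      have m2 : R.root s₂ ∈ Submodule.span ℝ {R.root s₁, R.root s₂} :=
        Submodule.subset_span (by simp)
      exact sub_mem (sub_mem ih.2.2 (Submodule.smul_mem _ _ m1)) (Submodule.smul_mem _ _ m2)
  set S := ∑ n ∈ Finset.range (orderOf k), R.rep (k ^ n) v with hS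
  have hXS : 0 < X S := by
    rw [hS, map_sum]
    exact Finset.sum_pos (fun n _ => (hpow n).2.1)
      (Finset.nonempty_range_iff.2 (orderOf_pos k).ne')
  have hSspan : S ∈ Submodule.span ℝ {R.root s₁, R.root s₂} :=
    Submodule.sum_mem _ fun n _ => (hpow n).2.2
  have hSfix : R.rep k S = S := by
    have e1 : R.rep k S = ∑ n ∈ Finset.range (orderOf k), R.rep (k ^ (n + 1)) v := by
      rw [hS, map_sum]
      refine Finset.sum_congr rfl fun n _ => ?_
      rw [pow_succ', R.rep_mul_apply k]
    have e2 := Finset.sum_range_succ (fun n => R.rep (k ^ n) v) (orderOf k)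
    rw [Finset.sum_range_succ', pow_orderOf_eq_one, pow_zero, ← e1] at e2
    exact add_right_cancel e2
  have h5 : R.rep s₁ S = R.rep s₂ S := by
    conv_rhs => rw [← hSfix]
    rw [hk, rep_mul_apply, R.rep_rep_self h₂.1]
  rw [R.rep_reflection s₁ h₁.1, R.rep_reflection s₂ h₂.1] at h5
  have h6 := R.root_indep h₁.1 h₂.1 hne (sub_right_injective h5)
  obtain ⟨a, b, hab⟩ := Submodule.mem_span_pair.1 hSspan
  have h7 : S = 0 := by
    apply R.form_self_eq_zero
    have : R.form S S = a * R.form (R.root s₁) S + b * R.form (R.root s₂) S := by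
      simpa using congrArg (fun z => R.form z S) hab.symm
    rw [this]
    linear_combination a / 2 * h6.1 + b / 2 * h6.2
  rw [h7, map_zero] at hXS
  exact lt_irrefl _ hXS

variable (E) in
/-- The coset of `x` under the dihedral group generated by the reflections of the plane. -/
def coset (x : W) : Set W := E.oddCoset x ∪ E.evenCoset x

theorem eq_of_mem_coset {x z z' : W} (hz : z ∈ E.coset x) (hz' : z' ∈ E.coset x)
    (h : inversionsIn cs E.refl z' = inversionsIn cs E.refl z) : z' = z := by
  have key : z' ∈ E.oddCoset z ∨ z' ∈ E.evenCoset z := by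
    rcases hz with hz | hz <;> rcases hz' with hz' | hz'
    · exact Or.inr (evenCoset_of_oddCoset hz' (oddCoset_comm hz))
    · exact Or.inl (oddCoset_of_evenCoset hz' (oddCoset_comm hz))
    · exact Or.inl (by rwa [oddCoset_eq_of_evenCoset hz])
    · obtain ⟨s, hs, s', hs', rfl⟩ := hz'
      right
      refine evenCoset_of_oddCoset (y := s' * x) ?_ ?_
      · rw [mul_assoc]; exact mul_mem_oddCoset hs _
      · rw [oddCoset_eq_of_evenCoset hz]; exact mul_mem_oddCoset hs' _
  rcases key with hk | ⟨s, hs, s', hs', rfl⟩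
  · exact absurd (congrArg Set.ncard h) (rank_ne_of_oddCoset hk)
  · have := eq_of_inversionsIn_eq hs hs' h
    rw [← this, mul_self_of_mem hs, one_mul]

theorem ncard_rank_le_two (x : W) (k : ℕ) : {z | z ∈ E.coset x ∧ E.rank z = k}.ncard ≤ 2 := by
  obtain ⟨σ, hσ⟩ := E.exists_slope
  choose c d hcd using hσ
  have hfin : ∀ z, (inversionsIn cs E.refl z).Finite := fun z => Set.toFinite _
  have nested : ∀ z z', (0 ≤ d z ∧ 0 ≤ d z' ∨ d z ≤ 0 ∧ d z' ≤ 0) →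
      inversionsIn cs E.refl z ⊆ inversionsIn cs E.refl z' ∨
        inversionsIn cs E.refl z' ⊆ inversionsIn cs E.refl z := by
    intro z z' hd
    by_contra! hcon
    obtain ⟨s, hs, hs'⟩ := Set.not_subset.1 hcon.1
    obtain ⟨r, hr, hr'⟩ := Set.not_subset.1 hcon.2
    have e1 := (hcd z s hs.1).1 hs
    have e2 := not_lt.1 (mt (hcd z' s hs.1).2 hs')
    have e3 := (hcd z' r hr.1).1 hr
    have e4 := not_lt.1 (mt (hcd z r hr.1).2 hr')
    rcases hd with ⟨h1, h2⟩ | ⟨h1, h2⟩ <;> rcases le_total (σ s) (σ r) with h3 | h3 <;> nlinarith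
  have heq : ∀ z z', z ∈ E.coset x → z' ∈ E.coset x → E.rank z = k → E.rank z' = k →
      (0 ≤ d z ∧ 0 ≤ d z' ∨ d z ≤ 0 ∧ d z' ≤ 0) → z = z' := by
    intro z z' hz hz' hk hk' hd
    rcases nested z z' hd with h | h
    · exact eq_of_mem_coset hz' hz
        (Set.eq_of_subset_of_ncard_le h (hk'.trans hk.symm).le (hfin _))
    · exact (eq_of_mem_coset hz hz'
        (Set.eq_of_subset_of_ncard_le h (hk.trans hk'.symm).le (hfin _))).symm
  by_contra! hlt
  obtain ⟨z₁, z₂, z₃, h1, h2, h3, h12, h13, h23⟩ := (Set.two_lt_ncard_iff (Set.toFinite _)).1 hlt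
  -- Among three elements, two have slopes of the same sign.
  rcases le_total 0 (d z₁) with d1 | d1 <;> rcases le_total 0 (d z₂) with d2 | d2 <;>
    rcases le_total 0 (d z₃) with d3 | d3 <;>
    first
    | exact h12 (heq z₁ z₂ h1.1 h2.1 h1.2 h2.2 (by tauto))
    | exact h13 (heq z₁ z₃ h1.1 h3.1 h1.2 h3.2 (by tauto))
    | exact h23 (heq z₂ z₃ h2.1 h3.1 h2.2 h3.2 (by tauto))

theorem ncard_rank_zero_le_one (x : W) : {z | z ∈ E.coset x ∧ E.rank z = 0}.ncard ≤ 1 := by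
  rw [Set.ncard_le_one (Set.toFinite _)]
  rintro z ⟨hz, h⟩ z' ⟨hz', h'⟩
  rw [rank, Set.ncard_eq_zero (Set.toFinite _)] at h h'
  exact eq_of_mem_coset hz' hz (h.trans h'.symm)

theorem ncard_rank_top_le_one (x : W) :
    {z | z ∈ E.coset x ∧ E.rank z = E.refl.ncard}.ncard ≤ 1 := by
  rw [Set.ncard_le_one (Set.toFinite _)]
  have key : ∀ z, E.rank z = E.refl.ncard → inversionsIn cs E.refl z = E.refl := fun z hz =>
    Set.eq_of_subset_of_ncard_le (fun _ hs => hs.1) hz.ge (Set.toFinite _)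
  rintro z ⟨hz, h⟩ z' ⟨hz', h'⟩
  exact eq_of_mem_coset hz' hz ((key z h).trans (key z' h').symm)

theorem ncard_coset {x t : W} (ht : t ∈ E.refl) : (E.coset x).ncard = 2 * E.refl.ncard := by
  have h1 : E.oddCoset x = (fun s => s * x) '' E.refl := by
    ext z
    constructor
    · intro hz
      obtain ⟨s, hs, rfl⟩ := exists_of_mem_oddCoset hz
      exact ⟨s, hs, rfl⟩
    · rintro ⟨s, hs, rfl⟩
      exact mul_mem_oddCoset hs x
  have h2 : E.evenCoset x = (fun s => t * (s * x)) '' E.refl := by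
    ext z
    constructor
    · rintro ⟨s, hs, s', hs', rfl⟩
      refine ⟨t * s * s', E.mul_mem ht hs hs', ?_⟩
      simp only [← mul_assoc, mul_self_of_mem ht, one_mul]
    · rintro ⟨s, hs, rfl⟩
      exact ⟨t, ht, s, hs, by rw [mul_assoc]⟩
  have hdisj : Disjoint (E.oddCoset x) (E.evenCoset x) := by
    rw [Set.disjoint_left]
    intro z hz hz'
    have := oddCoset_of_evenCoset (evenCoset_comm hz') hz
    exact rank_ne_of_oddCoset this rfl
  rw [coset, Set.ncard_union_eq hdisj (Set.toFinite _) (Set.toFinite _), h1, h2,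
    Set.ncard_image_of_injective _ (mul_left_injective x), Set.ncard_image_of_injective, two_mul]
  exact (mul_right_injective t).comp (mul_left_injective x)

/-- Every rank strictly between the bottom and the top rank is attained by two elements of a
coset, since the coset has twice as many elements as there are reflections in the plane while no
rank is attained more than twice, and the extreme ranks at most once. -/
theorem exists_pair_of_rank {x : W} {k : ℕ} (hk : 1 ≤ k) (hk' : k < E.refl.ncard) :
    ∃ a ∈ E.coset x, ∃ b ∈ E.coset x, a ≠ b ∧ E.rank a = k ∧ E.rank b = k := by
  classical
  obtain ⟨t, ht⟩ : E.refl.Nonempty := by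
    rw [← Set.ncard_pos (Set.toFinite _)]; omega
  by_contra hcon
  have hk1 : {z | z ∈ E.coset x ∧ E.rank z = k}.ncard ≤ 1 := by
    rw [Set.ncard_le_one (Set.toFinite _)]
    rintro a ⟨ha, ha'⟩ b ⟨hb, hb'⟩
    by_contra hab
    exact hcon ⟨a, ha, b, hb, hab, ha', hb'⟩
  set m := E.refl.ncard with hm
  have hfinC : (E.coset x).Finite := Set.toFinite _
  have hsum := Finset.card_eq_sum_card_fiberwise (f := E.rank) (s := hfinC.toFinset)
    (t := Finset.range (m + 1)) (fun z _ => by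
      have := E.rank_le z
      simp only [Finset.coe_range, Set.mem_Iio]
      omega)
  rw [← Set.ncard_eq_toFinset_card _ hfinC, ncard_coset ht] at hsum
  have hfib : ∀ j, (hfinC.toFinset.filter fun z => E.rank z = j).card =
      {z | z ∈ E.coset x ∧ E.rank z = j}.ncard := by
    intro j
    rw [← Set.ncard_coe_finset]
    congr 1
    ext z
    simp
  simp only [hfib] at hsum
  have hbound : ∀ j ∈ Finset.range (m + 1), {z | z ∈ E.coset x ∧ E.rank z = j}.ncard +
      ((if j = 0 then 1 else 0) + (if j = m then 1 else 0) + (if j = k then 1 else 0)) ≤ 2 := by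
    intro j _
    have b0 := ncard_rank_le_two (E := E) x j
    have b1 := ncard_rank_zero_le_one (E := E) x
    have b2 := ncard_rank_top_le_one (E := E) x
    rw [← hm] at b2
    by_cases j0 : j = 0
    · rw [j0, if_pos rfl, if_neg (by omega), if_neg (by omega)]
      omega
    by_cases jm : j = m
    · rw [jm, if_neg (by omega), if_pos rfl, if_neg (by omega)]
      omega
    by_cases jk : j = k
    · rw [jk, if_neg (by omega), if_neg (by omega), if_pos rfl]
      omega
    · rw [if_neg j0, if_neg jm, if_neg jk]
      omega
  have htot := Finset.sum_le_sum hbound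
  simp only [Finset.sum_add_distrib, Finset.sum_ite_eq', Finset.sum_const, Finset.card_range,
    Finset.mem_range, smul_eq_mul] at htot
  rw [← hsum, if_pos (by omega), if_pos (by omega), if_pos (by omega)] at htot
  omega

end RootModel.Frame

section BruhatGraph

variable {B W V : Type*} [Group W] {M : CoxeterMatrix B} {cs : CoxeterSystem M W}
  [AddCommGroup V] [Module ℝ V] [Finite W]

open RootModel.Frame

/-- A path of length two in the Bruhat graph is never the only one between its end points. -/
theorem exists_diamond (R : RootModel cs V) {x a y : W} (hxa : BruhatStep cs x a)
    (hay : BruhatStep cs a y) : ∃ a', a' ≠ a ∧ BruhatStep cs x a' ∧ BruhatStep cs a' y := by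
  obtain ⟨⟨p, hp, rfl⟩, hl⟩ := hxa
  obtain ⟨⟨q, hq, rfl⟩, hl'⟩ := hay
  have hpq : p ≠ q := by
    rintro rfl
    rw [← mul_assoc, hp.mul_self, one_mul] at hl'
    omega
  obtain ⟨E, hpE, hqE⟩ := R.exists_frame hp hq hpq
  have o1 := mul_mem_oddCoset hpE x
  have o2 := mul_mem_oddCoset hqE (p * x)
  have r1 := rank_lt_of_length_lt o1 hl
  have r2 := rank_lt_of_length_lt o2 hl'
  have r3 := E.rank_le (q * (p * x))
  obtain ⟨b, hb, c, hc, hbc, hbr, hcr⟩ :=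
    exists_pair_of_rank (E := E) (x := p * x) (k := E.rank (p * x)) (by omega) (by omega)
  obtain ⟨a', ha', hne, hr⟩ : ∃ a' ∈ E.coset (p * x), a' ≠ p * x ∧
      E.rank a' = E.rank (p * x) := by
    by_cases h : b = p * x
    · exact ⟨c, hc, by rw [← h]; exact hbc.symm, hcr⟩
    · exact ⟨b, hb, h, hbr⟩
  have hev : a' ∈ E.evenCoset (p * x) :=
    ha'.resolve_left fun h => rank_ne_of_oddCoset h hr
  refine ⟨a', hne, bruhatStep_of_rank_lt (oddCoset_of_evenCoset hev o1) (by omega),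
    bruhatStep_of_rank_lt (E := E) ?_ (by omega)⟩
  rw [oddCoset_eq_of_evenCoset hev]
  exact o2

/-- An edge of the Bruhat graph that is not a covering is the long diagonal of a hexagon of shorter
edges: the reflection lies in a plane in which the rank jumps by at least three. -/
theorem exists_hexagon (R : RootModel cs V) {x y : W} (hxy : BruhatStep cs x y)
    (hl : cs.length x + 1 < cs.length y) :
    ∃ a₁ a₂ b₁ b₂, a₁ ≠ a₂ ∧ b₁ ≠ b₂ ∧ BruhatStep cs x a₁ ∧ BruhatStep cs x a₂ ∧
      BruhatStep cs a₁ b₁ ∧ BruhatStep cs a₂ b₁ ∧ BruhatStep cs a₁ b₂ ∧ BruhatStep cs a₂ b₂ ∧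
      BruhatStep cs b₁ y ∧ BruhatStep cs b₂ y := by
  obtain ⟨⟨t, ht, rfl⟩, hlt⟩ := hxy
  obtain ⟨r, hr, hrt, hneg, h1, h2⟩ := R.exists_new_inversion
    (A := {s | cs.IsReflection s}) (t := t) (x := x) (fun s hs => hs) ht
    (fun s hs => hs.conj t) (by
      have e : ∀ z, (inversionsIn cs {s | cs.IsReflection s} z).ncard = cs.length z := fun z =>
        (R.length_eq_ncard z).symm
      rw [e, e]
      exact hl)
  obtain ⟨E, htE, hrE⟩ := R.exists_frame ht hr hrt.symm
  have h3 : E.rank x + 3 ≤ E.rank (t * x) := R.ncard_inversionsIn_add_three_le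
    (fun s hs => hs.1) htE (fun s hs => conj_mem hs htE) hlt hrE hrt hneg h1 h2
  have h4 := E.rank_le (t * x)
  have oy := mul_mem_oddCoset htE x
  obtain ⟨a₁, ha₁, a₂, ha₂, ha, hra₁, hra₂⟩ :=
    exists_pair_of_rank (E := E) (x := x) (k := E.rank x + 1) (by omega) (by omega)
  have oa₁ : a₁ ∈ E.oddCoset x := ha₁.resolve_right fun h => rank_ne_succ_of_evenCoset h hra₁
  have oa₂ : a₂ ∈ E.oddCoset x := ha₂.resolve_right fun h => rank_ne_succ_of_evenCoset h hra₂
  obtain ⟨b₁, hb₁, b₂, hb₂, hb, hrb₁, hrb₂⟩ :=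
    exists_pair_of_rank (E := E) (x := a₁) (k := E.rank x + 2) (by omega) (by omega)
  have ob₁ : b₁ ∈ E.oddCoset a₁ :=
    hb₁.resolve_right fun h => rank_ne_succ_of_evenCoset h (by omega)
  have ob₂ : b₂ ∈ E.oddCoset a₁ :=
    hb₂.resolve_right fun h => rank_ne_succ_of_evenCoset h (by omega)
  have haa : a₁ ∈ E.evenCoset a₂ := evenCoset_of_oddCoset oa₁ (oddCoset_comm oa₂)
  have hby : ∀ b ∈ E.oddCoset a₁, t * x ∈ E.oddCoset b := fun b hb => by
    rw [oddCoset_eq_of_evenCoset (evenCoset_of_oddCoset hb oa₁)]; exact oy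
  refine ⟨a₁, a₂, b₁, b₂, ha, hb, bruhatStep_of_rank_lt oa₁ (by omega),
    bruhatStep_of_rank_lt oa₂ (by omega), bruhatStep_of_rank_lt ob₁ (by omega),
    bruhatStep_of_rank_lt (E := E) ?_ (by omega), bruhatStep_of_rank_lt ob₂ (by omega),
    bruhatStep_of_rank_lt (E := E) ?_ (by omega), bruhatStep_of_rank_lt (hby _ ob₁) (by omega),
    bruhatStep_of_rank_lt (hby _ ob₂) (by omega)⟩
  · rwa [← oddCoset_eq_of_evenCoset haa]
  · rwa [← oddCoset_eq_of_evenCoset haa]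

end BruhatGraph

section Bruhat

variable {B W V : Type*} [Group W] {M : CoxeterMatrix B} {cs : CoxeterSystem M W}
  [AddCommGroup V] [Module ℝ V]

/-! ### Covers in the Bruhat order -/

variable (cs) in
/-- `y` covers `x` in the Bruhat order: an edge of the Bruhat graph whose end points have
consecutive lengths. -/
def BruhatCover (x y : W) : Prop := BruhatStep cs x y ∧ cs.length y = cs.length x + 1

theorem BruhatStep.le {x y : W} (h : BruhatStep cs x y) : BruhatLE cs x y :=
  Relation.ReflTransGen.single h

theorem BruhatStep.adj {x y : W} (h : BruhatStep cs x y) : (bruhatGraph cs).Adj x y := Or.inl h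

theorem BruhatLE.trans {x y z : W} (h : BruhatLE cs x y) (h' : BruhatLE cs y z) :
    BruhatLE cs x z := Relation.ReflTransGen.trans h h'

theorem BruhatLE.length_le {x y : W} (h : BruhatLE cs x y) : cs.length x ≤ cs.length y := by
  rcases h.length_lt_or_eq with h | rfl
  · exact h.le
  · exact le_rfl

theorem BruhatLE.eq_of_length_le {x y : W} (h : BruhatLE cs x y)
    (hl : cs.length y ≤ cs.length x) : x = y :=
  h.length_lt_or_eq.resolve_left (by omega)

theorem BruhatStep.exists_cover [Finite W] (R : RootModel cs V) {x y : W} (h : BruhatStep cs x y) :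
    ∃ z, BruhatCover cs x z ∧ BruhatLE cs z y := by
  induction hn : cs.length y using Nat.strong_induction_on generalizing y with
  | _ n ih =>
  subst hn
  by_cases hl : cs.length x + 1 < cs.length y
  · obtain ⟨a, -, b, -, -, -, hxa, -, hab, -, -, -, hby, -⟩ := exists_hexagon R h hl
    obtain ⟨z, hz, hza⟩ := ih _ (hab.2.trans hby.2) hxa rfl
    exact ⟨z, hz, hza.trans (hab.le.trans hby.le)⟩
  · exact ⟨y, ⟨h, by have := h.2; omega⟩, Relation.ReflTransGen.refl⟩

/-- The Bruhat order is graded by the length. -/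
theorem BruhatLE.exists_cover [Finite W] (R : RootModel cs V) {x y : W}
    (h : BruhatLE cs x y) (hne : x ≠ y) :
    ∃ z, BruhatCover cs x z ∧ BruhatLE cs z y := by
  rcases Relation.ReflTransGen.cases_head h with rfl | ⟨c, hxc, hcy⟩
  · exact absurd rfl hne
  · obtain ⟨z, hz, hzc⟩ := hxc.exists_cover R
    exact ⟨z, hz, hzc.trans hcy⟩

theorem BruhatLE.step_of_length [Finite W] (R : RootModel cs V) {x y : W} (h : BruhatLE cs x y)
    (hl : cs.length y = cs.length x + 1) : BruhatStep cs x y := by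
  obtain ⟨z, hz, hzy⟩ := h.exists_cover R (by rintro rfl; omega)
  have := hzy.eq_of_length_le (by have := hz.2; omega)
  rw [← this]
  exact hz.1

/-! ### Special matchings of Bruhat intervals -/

variable (cs) in
/-- `f` restricts to a special matching of the Bruhat interval `[u, x]`. -/
structure IsSpecialOn (u x : W) (f : W → W) : Prop where
  mem : ∀ z ∈ bruhatInterval cs u x, f z ∈ bruhatInterval cs u x
  invol : ∀ z ∈ bruhatInterval cs u x, f (f z) = z
  cover : ∀ z ∈ bruhatInterval cs u x, BruhatCover cs (f z) z ∨ BruhatCover cs z (f z)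
  special : ∀ z ∈ bruhatInterval cs u x, ∀ z' ∈ bruhatInterval cs u x, BruhatCover cs z z' →
    f z = z' ∨ (BruhatLE cs (f z) (f z') ∧ f z ≠ f z')

theorem mem_bruhatInterval_of_le {u w x y z : W} (hx : x ∈ bruhatInterval cs u w)
    (hy : y ∈ bruhatInterval cs u w) (hxz : BruhatLE cs x z) (hzy : BruhatLE cs z y) :
    z ∈ bruhatInterval cs u w :=
  ⟨BruhatLE.trans hx.1 hxz, BruhatLE.trans hzy hy.2⟩

theorem IsSpecialOn.injOn {u w : W} {f : W → W} (hf : IsSpecialOn cs u w f) :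
    Set.InjOn f (bruhatInterval cs u w) := by
  intro x hx y hy h
  rw [← hf.invol x hx, h, hf.invol y hy]

/-- A special matching of a Bruhat interval maps a covering to an edge. If it
stretches the covering `x < y` to an interval of length three, then a second atom `z` of that
interval and the coatom `f z` complete `x` and `y` to a hexagon. -/
theorem IsSpecialOn.adj_of_cover [Finite W] (R : RootModel cs V) {u w : W} {f : W → W}
    (hf : IsSpecialOn cs u w f) {x y : W} (hx : x ∈ bruhatInterval cs u w)
    (hy : y ∈ bruhatInterval cs u w) (hxy : BruhatCover cs x y) :
    (bruhatGraph cs).Adj (f x) (f y) := by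
  have hl := hxy.2
  by_cases hfx : f x = y
  · rw [← hfx, hf.invol x hx, hfx]
    exact hxy.1.adj.symm
  obtain ⟨hle, hne⟩ := (hf.special x hx y hy hxy).resolve_left hfx
  have hlt : cs.length (f x) < cs.length (f y) := hle.length_lt_or_eq.resolve_right hne
  by_cases hd : cs.length (f y) = cs.length (f x) + 1
  · exact (hle.step_of_length R hd).adj
  rcases hf.cover x hx with hcx | hcx <;> rcases hf.cover y hy with hcy | hcy <;>
    have h1 := hcx.2 <;> have h2 := hcy.2
  · omega
  · obtain ⟨z, hzx, hpz, hzy⟩ := exists_diamond R hcx.1 hxy.1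
    have hp := hf.mem x hx
    have hq := hf.mem y hy
    have hz : z ∈ bruhatInterval cs u w := mem_bruhatInterval_of_le hp hy hpz.le hzy.le
    have hzl : cs.length z = cs.length x := by have := hpz.2; have := hzy.2; omega
    obtain ⟨h3, h4⟩ := (hf.special _ hp z hz ⟨hpz, by omega⟩).resolve_left
      (by rw [hf.invol x hx]; exact hzx.symm)
    rw [hf.invol x hx] at h3 h4
    have h5 := h3.length_lt_or_eq.resolve_right h4
    have hcz : BruhatCover cs z (f z) := (hf.cover z hz).resolve_left fun h => by
      have := h.2
      omega
    have h6 := hcz.2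
    have hfz : f z ≠ y := by
      intro h
      rw [← h, hf.invol z hz] at h2
      omega
    obtain ⟨h7, -⟩ := (hf.special z hz y hy ⟨hzy, by omega⟩).resolve_left hfz
    exact adj_of_hexagon R hzx.symm hfz.symm hcx.1.adj hpz.adj hxy.1.adj hzy.adj
      (h3.step_of_length R (by omega)).adj hcz.1.adj hcy.1.adj
      (h7.step_of_length R (by omega)).adj
  · omega
  · omega

/-- A special matching of a Bruhat interval is an automorphism of its Bruhat graph. -/
theorem IsSpecialOn.adj_of_step [Finite W] (R : RootModel cs V) {u w : W} {f : W → W}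
    (hf : IsSpecialOn cs u w f) {x y : W} (hx : x ∈ bruhatInterval cs u w)
    (hy : y ∈ bruhatInterval cs u w) (hxy : BruhatStep cs x y) :
    (bruhatGraph cs).Adj (f x) (f y) := by
  induction hn : cs.length y - cs.length x using Nat.strong_induction_on generalizing x y with
  | _ n ih =>
  subst hn
  by_cases hl : cs.length x + 1 < cs.length y
  · obtain ⟨a₁, a₂, b₁, b₂, ha, hb, xa₁, xa₂, ab₁₁, ab₂₁, ab₁₂, ab₂₂, by₁, by₂⟩ :=
      exists_hexagon R hxy hl
    have ma₁ := mem_bruhatInterval_of_le hx hy xa₁.le (ab₁₁.le.trans by₁.le)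
    have ma₂ := mem_bruhatInterval_of_le hx hy xa₂.le (ab₂₁.le.trans by₁.le)
    have mb₁ := mem_bruhatInterval_of_le hx hy (xa₁.le.trans ab₁₁.le) by₁.le
    have mb₂ := mem_bruhatInterval_of_le hx hy (xa₁.le.trans ab₁₂.le) by₂.le
    have l1 := xa₁.2
    have l2 := xa₂.2
    have l3 := ab₁₁.2
    have l4 := ab₂₁.2
    have l5 := ab₁₂.2
    have l6 := ab₂₂.2
    have l7 := by₁.2
    have l8 := by₂.2
    exact adj_of_hexagon R (fun h => ha (hf.injOn ma₁ ma₂ h)) (fun h => hb (hf.injOn mb₁ mb₂ h))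
      (ih _ (by omega) hx ma₁ xa₁ rfl) (ih _ (by omega) hx ma₂ xa₂ rfl)
      (ih _ (by omega) ma₁ mb₁ ab₁₁ rfl) (ih _ (by omega) ma₂ mb₁ ab₂₁ rfl)
      (ih _ (by omega) ma₁ mb₂ ab₁₂ rfl) (ih _ (by omega) ma₂ mb₂ ab₂₂ rfl)
      (ih _ (by omega) mb₁ hy by₁ rfl) (ih _ (by omega) mb₂ hy by₂ rfl)
  · exact hf.adj_of_cover R hx hy ⟨hxy, by have := hxy.2; omega⟩

/-- The number of edges of the Bruhat graph of `[u, w]` at `w`, by induction on the length of `w`: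
a special matching of `[u, w]` matches the neighbours of `w` other than its partner with the
neighbours of that partner. -/
theorem ncard_step_add_length [Finite W] (R : RootModel cs V) {u w : W} (hle : BruhatLE cs u w)
    (hs : ∀ x, BruhatLE cs u x → u ≠ x → BruhatLE cs x w → ∃ f, IsSpecialOn cs u x f) :
    {z | BruhatLE cs u z ∧ BruhatStep cs z w}.ncard + cs.length u = cs.length w := by
  induction hn : cs.length w using Nat.strong_induction_on generalizing w with
  | _ n ih =>
  subst hn
  rcases eq_or_ne u w with rfl | hne
  · have : {z | BruhatLE cs u z ∧ BruhatStep cs z u} = ∅ := by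
      ext z
      simp only [Set.mem_ofPred_eq, Set.mem_empty_iff_false, iff_false, not_and]
      intro h1 h2
      have := h1.length_le
      have := h2.2
      omega
    rw [this, Set.ncard_empty, zero_add]
  obtain ⟨f, hf⟩ := hs w hle hne Relation.ReflTransGen.refl
  have hw : w ∈ bruhatInterval cs u w := ⟨hle, Relation.ReflTransGen.refl⟩
  have hw' := hf.mem w hw
  have hc : BruhatCover cs (f w) w := (hf.cover w hw).resolve_right fun h => by
    have := hw'.2.length_le
    have := h.2
    omega
  have hcl := hc.2
  have hih := ih _ (by omega) hw'.1 (fun x h1 h2 h3 => hs x h1 h2 (h3.trans hc.1.le)) rfl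
  have hsub : {z | BruhatLE cs u z ∧ BruhatStep cs z (f w)} ⊆ bruhatInterval cs u w :=
    fun z hz => ⟨hz.1, hz.2.le.trans hc.1.le⟩
  have hset : {z | BruhatLE cs u z ∧ BruhatStep cs z w} =
      insert (f w) (f '' {z | BruhatLE cs u z ∧ BruhatStep cs z (f w)}) := by
    ext z
    rw [Set.mem_insert_iff]
    constructor
    · rintro ⟨hz, hzw⟩
      have hzm : z ∈ bruhatInterval cs u w := ⟨hz, hzw.le⟩
      have hfz := hf.mem z hzm
      rcases hf.adj_of_step R hzm hw hzw with h | h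
      · exact Or.inr ⟨f z, ⟨hfz.1, h⟩, hf.invol z hzm⟩
      · left
        have h1 := hfz.2.eq_of_length_le (by have := h.2; omega)
        rw [← h1, hf.invol z hzm]
    · rintro (rfl | ⟨z, hz, rfl⟩)
      · exact ⟨hw'.1, hc.1⟩
      · have hzm := hsub hz
        have hfz := hf.mem z hzm
        refine ⟨hfz.1, ?_⟩
        have h := hf.adj_of_step R hzm hw' hz.2
        rw [hf.invol w hw] at h
        refine h.resolve_right fun h' => ?_
        have := hfz.2.length_le
        have := h'.2
        omega
  have hnot : f w ∉ f '' {z | BruhatLE cs u z ∧ BruhatStep cs z (f w)} := by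
    rintro ⟨z, hz, h⟩
    have h1 := hf.injOn (hsub hz) hw h
    have := hz.2.2
    rw [h1] at this
    omega
  rw [hset, Set.ncard_insert_of_notMem hnot (Set.toFinite _),
    (hf.injOn.mono hsub).ncard_image]
  omega

/-- Covers in a principal order ideal of a Bruhat interval are the covers of the Bruhat order. -/
theorem covBy_iff_bruhatCover [Finite W] (R : RootModel cs V) {u w : W} {x : bruhatInterval cs u w}
    {y z : Set.Iic x} : y ⋖ z ↔ BruhatCover cs y.1.1 z.1.1 := by
  constructor
  · intro h
    have hle : BruhatLE cs y.1.1 z.1.1 := h.1.le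
    have hne : y.1.1 ≠ z.1.1 := fun he => h.1.ne (Subtype.ext (Subtype.ext he))
    obtain ⟨c, hc, hcz⟩ := hle.exists_cover R hne
    have hcm : c ∈ bruhatInterval cs u w := mem_bruhatInterval_of_le y.1.2 z.1.2 hc.1.le hcz
    have hcx : (⟨c, hcm⟩ : bruhatInterval cs u w) ≤ x :=
      le_trans (show (⟨c, hcm⟩ : bruhatInterval cs u w) ≤ z.1 from hcz) z.2
    by_cases hcz' : c = z.1.1
    · rwa [← hcz']
    · exfalso
      refine h.2 (c := ⟨⟨c, hcm⟩, hcx⟩) (lt_of_le_of_ne hc.1.le fun he => ?_)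
        (lt_of_le_of_ne hcz fun he => hcz' (congrArg (fun a => a.1.1) he))
      have h1 : y.1.1 = c := congrArg (fun a => a.1.1) he
      have := hc.2
      rw [h1] at this
      omega
  · intro h
    refine ⟨lt_of_le_of_ne h.1.le ?_, ?_⟩
    · rintro rfl
      exact lt_irrefl _ h.1.2
    · intro c hyc hcz
      have key : ∀ {a b : Set.Iic x}, a < b → cs.length a.1.1 < cs.length b.1.1 := by
        intro a b hab
        have hle : BruhatLE cs a.1.1 b.1.1 := hab.le
        exact hle.length_lt_or_eq.resolve_right
          fun he => hab.ne (Subtype.ext (Subtype.ext he))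
      have h1 := key hyc
      have h2 := key hcz
      have h3 := h.2
      omega

theorem IsZircon.exists_isSpecialOn [Finite W] (R : RootModel cs V) {u w : W}
    (hz : IsZircon (bruhatInterval cs u w)) {x : W} (hux : BruhatLE cs u x) (hne : u ≠ x)
    (hxw : BruhatLE cs x w) : ∃ f, IsSpecialOn cs u x f := by
  classical
  let X : bruhatInterval cs u w := ⟨x, hux, hxw⟩
  have hmin : ¬ IsMin X := by
    intro h
    have hu : u ∈ bruhatInterval cs u w := ⟨Relation.ReflTransGen.refl, hux.trans hxw⟩
    have h1 : BruhatLE cs x u := h (b := ⟨u, hu⟩) hux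
    exact hne (hux.antisymm _ h1)
  obtain ⟨-, f, ⟨hinv, hcov⟩, hspec⟩ := hz X hmin
  let ι : ∀ z ∈ bruhatInterval cs u x, Set.Iic X := fun z h => ⟨⟨z, h.1, h.2.trans hxw⟩, h.2⟩
  have hmem : ∀ y : Set.Iic X, y.1.1 ∈ bruhatInterval cs u x := fun y => ⟨y.1.2.1, y.2⟩
  let F : W → W := fun z =>
    if h : z ∈ bruhatInterval cs u x then (f (ι z h)).1.1 else z
  have hF : ∀ z (h : z ∈ bruhatInterval cs u x), F z = (f (ι z h)).1.1 := fun z h => dif_pos h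
  refine ⟨F, ?_, ?_, ?_, ?_⟩
  · intro z h
    rw [hF z h]
    exact hmem _
  · intro z h
    have h1 : F z ∈ bruhatInterval cs u x := by rw [hF z h]; exact hmem _
    have h2 : ι (F z) h1 = f (ι z h) := Subtype.ext (Subtype.ext (hF z h))
    rw [hF _ h1, h2, hinv]
  · intro z h
    rw [hF z h]
    exact (hcov (ι z h)).imp (covBy_iff_bruhatCover R).1 (covBy_iff_bruhatCover R).1
  · intro z h z' h' hzz
    rw [hF z h, hF z' h']
    refine (hspec (ι z h) (ι z' h') ((covBy_iff_bruhatCover R).2 hzz)).imp ?_ ?_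
    · intro he
      rw [he]
    · intro hlt
      exact ⟨hlt.le, fun he => hlt.ne (Subtype.ext (Subtype.ext he))⟩

theorem bruhatDegree_top {u w : W} (hle : BruhatLE cs u w) :
    bruhatDegree cs u w ⟨w, right_mem_bruhatInterval cs hle⟩ =
      {z | BruhatLE cs u z ∧ BruhatStep cs z w}.ncard := by
  rw [bruhatDegree, ← Set.ncard_image_of_injective _ Subtype.val_injective]
  congr 1
  ext z
  constructor
  · rintro ⟨⟨z, hz⟩, hadj, rfl⟩
    refine ⟨hz.1, ?_⟩
    have h : BruhatStep cs w z ∨ BruhatStep cs z w := hadj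
    refine h.resolve_left fun h' => ?_
    have := hz.2.length_le
    have := h'.2
    omega
  · rintro ⟨hz, hzw⟩
    exact ⟨⟨z, hz, hzw.le⟩, show BruhatStep cs w z ∨ BruhatStep cs z w from Or.inr hzw, rfl⟩

end Bruhat

end BruhatZircon

theorem mainTheorem2 {B W : Type*} [Group W] {M : CoxeterMatrix B} (cs : CoxeterSystem M W)
    (hW : BruhatZircon.IsWeylGroup cs) (u w : W)
    (hle : BruhatZircon.BruhatLE cs u w) (hne : u ≠ w)
    (hz : BruhatZircon.IsZircon (BruhatZircon.bruhatInterval cs u w)) :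
    (BruhatZircon.bruhatDegree cs u w
        ⟨w, BruhatZircon.right_mem_bruhatInterval cs hle⟩ : ℤ) =
      (cs.length w : ℤ) - (cs.length u : ℤ) := by
  have := hW.1
  have hM : ∀ i j, M i j ≠ 0 := by
    intro i j
    rcases eq_or_ne i j with rfl | hij
    · rw [M.diagonal]; exact one_ne_zero
    · rcases hW.2 i j hij with h | h | h | h <;> rw [h] <;> norm_num
  obtain ⟨R⟩ := BruhatZircon.nonempty_rootModel cs hM
  have key := BruhatZircon.ncard_step_add_length R hle
    (fun x h1 h2 h3 => hz.exists_isSpecialOn R h1 h2 h3)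
  rw [← BruhatZircon.bruhatDegree_top hle] at key
  rw [← key]
  push_cast
  ring
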